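/- **Setting.** Let $\mathcal D$ be a smooth distribution of rank $n$ and corank $p$ on $\mathbb R^N$, $N=n+p$, and let $\lambda^1,\dots,\lambda^p$ be any smooth, pointwise linearly independent $1$-forms on $\mathbb R^N$ with $\mathcal D=\bigcap_s\ker\lambda^s$. Let $\mathcal D^0=0$, $\mathcal D^1=\mathcal D$, $\mathcal D^{i+1}=\mathcal D^i+[\mathcal D,\mathcal D^i]$ as sheaves of vector fields (brackets spanned over smooth functions), and let $\mathcal D^i_y\subset T_y\mathbb R^N$ be the space of values at $y$ of their local sections. $\mathcal D$ is bracket-generating if for each $y$ there is $i$ with $\mathcal D^i_y=T_y\mathbb R^N$; it has type $\mathfrak m=(m_0\le\dots\le m_{r+1}=N)$ at $y$ if $m_i=\dim\mathcal D^i_y$ for $0\le i\le r+1$. For $u:\mathbb R\to\mathbb R^N$ put $\mathfrak D(u)=\big(\lambda^s_{u(t)}(\partial_tu)\big)_{s=1}^p$, and let $\mathcal R^\alpha_{\mathrm{tang}}$ be the set of jets $j^{\alpha+1}_u(x)$ with $j^\alpha_{\mathfrak D(u)}(x)=0$ (the $\alpha$-infinitesimal solutions of $\mathfrak D=0$). Let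 $R_u=\big(d\lambda^s(\partial_tu,\partial_\mu)\big)$ and $\Lambda=\big(\lambda^s(\partial_\mu)\circ u\big)$, which are $p\times N$ matrices of functions of $t$. For $q\ge0$ let $A_q=A_q(j^{q+1}_u(x))$ be the $p(q+2)\times N(q+1)$ matrix whose block in row-block $i$ and column-block $k$ ($0\le i\le q+1$, $0\le k\le q$) is $$\binom ki\,\partial_t^{k-i}R_u+\binom k{i-1}\,\partial_t^{k-i+1}\Lambda\ \Big|_x ,$$ where terms with an out-of-range binomial coefficient are $0$. For $q\le\alpha$ let $\mathcal W^q_\alpha\subset\mathcal R^\alpha_{\mathrm{tang}}$ be the set of those jets $j^{\alpha+1}_u(x)\in\mathcal R^\alpha_{\mathrm{tang}}$ for which $\partial_tu(x)\ne0$ and $A_q(j^{q+1}_u(x))$ has full row rank (the $\mathcal W$-regular $\alpha$-infinitesimal solutions). For a $1$-jet $\sigma$, write $\mathcal R^\alpha_{\mathrm{tang}}|_\sigma$ and $\mathcal W^q_\alpha|_\sigma$ for the sets of jets in $\mathcal R^\alpha_{\mathrm{tang}}$ and $\mathcal W^q_\alpha$ that project to $\sigma$. In the coordinates $\partial_t^iu^\mu(x)$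 these are subsets of a finite-dimensional real vector space; the dimension of a subset is the Krull dimension of the ring of polynomial functions on it (the dimension of its Zariski closure), and codimension is understood accordingly, the empty set having every codimension. **Theorem.** Let $n,p,q_0\ge0$ be integers with $nq_0\ge p-n$, let $N=n+p$, let $\mathfrak m=(m_0,\dots,m_{r+1})$ be a tuple of non-negative integers, and let $K\ge1$. There is an integer $q(\mathfrak m,K)\ge q_0$ (depending only on $\mathfrak m$, $K$ and $q_0$) such that the following holds. Let $\mathcal D$ be a bracket-generating distribution of rank $n$ and corank $p$ on $\mathbb R^N$ with defining forms $\lambda^1,\dots,\lambda^p$ as above, let $\sigma=j^1_u(x)\in\mathcal R^0_{\mathrm{tang}}$ be a horizontal $1$-jet with $\partial_tu(x)\neq0$, and suppose that $\mathcal D$ has type $\mathfrak m$ at $u(x)$. Then for all $q\ge q(\mathfrak m,K)$ and all $\alpha\ge q$, the complement $\mathcal R^\alpha_{\mathrm{tang}}|_\sigma\setminus\mathcal W^q_\alpha|_\sigma$ has codimension at least $K$ in $\mathcal R^\alpha_{\mathrm{tang}}|_\sigma$. -/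

import Mathlib

open scoped ContDiff

noncomputable section

/-! ### Distributions on `ℝᴺ` and their Lie flag -/

/-- `D` is a smooth distribution of rank `n` on `ℝᴺ`: a field of subspaces of the tangent spaces
which is locally spanned by `n` smooth, pointwise linearly independent vector fields. -/
def IsDistribution {N : ℕ} (n : ℕ) (D : (Fin N → ℝ) → Submodule ℝ (Fin N → ℝ)) : Prop :=
  ∀ y₀, ∃ (U : Set (Fin N → ℝ)) (X : Fin n → (Fin N → ℝ) → (Fin N → ℝ)),
    IsOpen U ∧ y₀ ∈ U ∧ (∀ i, ContDiffOn ℝ ∞ (X i) U) ∧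
      ∀ y ∈ U, LinearIndependent ℝ (fun i => X i y) ∧
        D y = Submodule.span ℝ (Set.range fun i => X i y)

/-- `IsFlagSection D U i X`: on the open set `U`, the vector field `X` is a section of the sheaf
`𝒟ⁱ`, where `𝒟⁰ = 0`, `𝒟¹ = Γ(D)` and `𝒟ⁱ⁺¹ = 𝒟ⁱ + [𝒟, 𝒟ⁱ]`; the bracket of two sheaves is the
span, over smooth functions, of the Lie brackets of their local sections. -/
inductive IsFlagSection {N : ℕ} (D : (Fin N → ℝ) → Submodule ℝ (Fin N → ℝ))
    (U : Set (Fin N → ℝ)) : ℕ → ((Fin N → ℝ) → (Fin N → ℝ)) → Prop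
  | zero : IsFlagSection D U 0 (fun _ => 0)
  | base {X : (Fin N → ℝ) → (Fin N → ℝ)} (hX : ContDiffOn ℝ ∞ X U) (hD : ∀ y ∈ U, X y ∈ D y) :
      IsFlagSection D U 1 X
  | mono {i : ℕ} {X : (Fin N → ℝ) → (Fin N → ℝ)} (hX : IsFlagSection D U i X) :
      IsFlagSection D U (i + 1) X
  | bracket {i : ℕ} {X Y : (Fin N → ℝ) → (Fin N → ℝ)} (hX : IsFlagSection D U 1 X)
      (hY : IsFlagSection D U i Y) :
      IsFlagSection D U (i + 1) (VectorField.lieBracket ℝ X Y)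
  | add {i : ℕ} {X Y : (Fin N → ℝ) → (Fin N → ℝ)} (hX : IsFlagSection D U i X)
      (hY : IsFlagSection D U i Y) : IsFlagSection D U i (fun y => X y + Y y)
  | smul {i : ℕ} {f : (Fin N → ℝ) → ℝ} {X : (Fin N → ℝ) → (Fin N → ℝ)}
      (hf : ContDiffOn ℝ ∞ f U) (hX : IsFlagSection D U i X) :
      IsFlagSection D U i (fun y => f y • X y)

/-- The subspace `𝒟ⁱ_y ⊆ T_y ℝᴺ` of values at `y` of the sections of `𝒟ⁱ` defined near `y`.
(These values already form a subspace.) -/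
def flagAt {N : ℕ} (D : (Fin N → ℝ) → Submodule ℝ (Fin N → ℝ)) (i : ℕ) (y : Fin N → ℝ) :
    Submodule ℝ (Fin N → ℝ) :=
  Submodule.span ℝ {v | ∃ (U : Set (Fin N → ℝ)) (X : (Fin N → ℝ) → (Fin N → ℝ)),
    IsOpen U ∧ y ∈ U ∧ IsFlagSection D U i X ∧ X y = v}

/-- `D` is bracket-generating: at each point `y` some `𝒟ⁱ_y` is the whole tangent space. -/
def IsBracketGenerating {N : ℕ} (D : (Fin N → ℝ) → Submodule ℝ (Fin N → ℝ)) : Prop :=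
  ∀ y, ∃ i, flagAt D i y = ⊤

/-- `D` has type `m = (m₀, …, m_{r+1})` at `y`: `mᵢ = dim 𝒟ⁱ_y` and `m_{r+1} = N`. -/
def HasTypeAt {N r : ℕ} (D : (Fin N → ℝ) → Submodule ℝ (Fin N → ℝ)) (m : Fin (r + 2) → ℕ)
    (y : Fin N → ℝ) : Prop :=
  (∀ i : Fin (r + 2), Module.finrank ℝ (flagAt D i y) = m i) ∧ m (Fin.last (r + 1)) = N

/-- The smooth `1`-forms `lam 0, …, lam (p - 1)` form a defining coframe for `D`: they are
linearly independent at each point, and `D` is their common kernel. -/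
def IsDefiningCoframe {N p : ℕ} (D : (Fin N → ℝ) → Submodule ℝ (Fin N → ℝ))
    (lam : Fin p → (Fin N → ℝ) → ((Fin N → ℝ) →L[ℝ] ℝ)) : Prop :=
  (∀ s, ContDiff ℝ ∞ (lam s)) ∧ (∀ y, LinearIndependent ℝ (fun s => lam s y)) ∧
    ∀ y v, v ∈ D y ↔ ∀ s, lam s y v = 0

/-! ### Jets of curves -/

/-- The space of `k`-jets, at a given point of `ℝ`, of maps `ℝ → ℝᴺ`, in its standard
coordinates: the coordinate `(i, μ)` is the value of `∂ₜⁱ u^μ`, for `0 ≤ i ≤ k`. -/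
abbrev JetAt (k N : ℕ) : Type := Fin (k + 1) × Fin N → ℝ

/-- The jet `jᵏ_u(x)`. -/
def jet {N : ℕ} (k : ℕ) (u : ℝ → Fin N → ℝ) (x : ℝ) : JetAt k N :=
  fun a => iteratedDeriv (a.1 : ℕ) u x a.2

/-- The jet projection `pˡₖ`. -/
def jetProj {k l N : ℕ} (h : k ≤ l) (j : JetAt l N) : JetAt k N :=
  fun a => j (Fin.castLE (Nat.succ_le_succ h) a.1, a.2)

/-- The value `u(x)` of a `1`-jet `j¹_u(x)`. -/
def jetValue {N : ℕ} (σ : JetAt 1 N) : Fin N → ℝ := fun μ => σ (0, μ)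

/-- The velocity `∂ₜu(x)` of a `1`-jet `j¹_u(x)`. -/
def jetVelocity {N : ℕ} (σ : JetAt 1 N) : Fin N → ℝ := fun μ => σ (1, μ)

/-! ### Horizontality and regularity -/

/-- The operator `𝔇(u) = (u^*λˢ)(∂ₜ) = λˢ_{u(t)}(∂ₜu)`, whose zeros are the horizontal curves. -/
def horizOp {N p : ℕ} (lam : Fin p → (Fin N → ℝ) → ((Fin N → ℝ) →L[ℝ] ℝ))
    (u : ℝ → Fin N → ℝ) : ℝ → Fin p → ℝ :=
  fun t s => lam s (u t) (deriv u t)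

/-- `ℛ^α_tang` at `x`: the `(α+1)`-jets at `x` of maps `u` with `j^α_{𝔇(u)}(x) = 0`. -/
def tangJets {N p : ℕ} (lam : Fin p → (Fin N → ℝ) → ((Fin N → ℝ) →L[ℝ] ℝ)) (α : ℕ) (x : ℝ) :
    Set (JetAt (α + 1) N) :=
  {j | ∃ u : ℝ → Fin N → ℝ, ContDiff ℝ ∞ u ∧ jet (α + 1) u x = j ∧
    ∀ k ≤ α, iteratedDeriv k (horizOp lam u) x = 0}

/-- The exterior derivative of a `1`-form, `dη_y(v, w) = (∂_v η)(w) - (∂_w η)(v)`. -/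
def extD {N : ℕ} (η : (Fin N → ℝ) → ((Fin N → ℝ) →L[ℝ] ℝ)) (y v w : Fin N → ℝ) : ℝ :=
  fderiv ℝ η y v w - fderiv ℝ η y w v

/-- The entries of the `p × N` matrix `R_u`: `dλˢ_{u(t)}(∂ₜu, ∂_μ)`. -/
def entryR {N p : ℕ} (lam : Fin p → (Fin N → ℝ) → ((Fin N → ℝ) →L[ℝ] ℝ))
    (u : ℝ → Fin N → ℝ) (s : Fin p) (μ : Fin N) (t : ℝ) : ℝ :=
  extD (lam s) (u t) (deriv u t) (Pi.single μ 1)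

/-- The entries of the `p × N` matrix `Λ`: `λˢ_{u(t)}(∂_μ)`. -/
def entryLambda {N p : ℕ} (lam : Fin p → (Fin N → ℝ) → ((Fin N → ℝ) →L[ℝ] ℝ))
    (u : ℝ → Fin N → ℝ) (s : Fin p) (μ : Fin N) (t : ℝ) : ℝ :=
  lam s (u t) (Pi.single μ 1)

/-- The entry `(s, μ)` of the block in row-block `i` and column-block `k` of the regularity matrix,
at time `x`. The block is `C(k,i) ∂ₜᵏ⁻ⁱ R_u + C(k,i-1) ∂ₜᵏ⁻ⁱ⁺¹ Λ`, where binomial coefficients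
out of range vanish; so it is `Λ` for `i = k + 1` and `0` for `i > k + 1`. -/
def blockEntry {N p : ℕ} (lam : Fin p → (Fin N → ℝ) → ((Fin N → ℝ) →L[ℝ] ℝ))
    (u : ℝ → Fin N → ℝ) (x : ℝ) (k : ℕ) (s : Fin p) (μ : Fin N) : ℕ → ℝ
  | 0 => iteratedDeriv k (entryR lam u s μ) x
  | i + 1 => (k.choose (i + 1) : ℝ) * iteratedDeriv (k - (i + 1)) (entryR lam u s μ) x
      + (k.choose i : ℝ) * iteratedDeriv (k - i) (entryLambda lam u s μ) x

/-- The `p(q+2) × N(q+1)` regularity matrix `A`, depending on the `(q+1)`-jet of `u` at `x`. -/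
def regMatrix {N p : ℕ} (lam : Fin p → (Fin N → ℝ) → ((Fin N → ℝ) →L[ℝ] ℝ)) (q : ℕ)
    (u : ℝ → Fin N → ℝ) (x : ℝ) : Matrix (Fin (q + 2) × Fin p) (Fin (q + 1) × Fin N) ℝ :=
  fun a b => blockEntry lam u x (b.1 : ℕ) a.2 b.2 (a.1 : ℕ)

/-- The relation `𝒲` of order `q + 1`, at `x`: the jets of maps that are immersive at `x` and
whose regularity matrix has full row rank. -/
def regJets {N p : ℕ} (lam : Fin p → (Fin N → ℝ) → ((Fin N → ℝ) →L[ℝ] ℝ)) (q : ℕ) (x : ℝ) :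
    Set (JetAt (q + 1) N) :=
  {j | ∃ u : ℝ → Fin N → ℝ, ContDiff ℝ ∞ u ∧ jet (q + 1) u x = j ∧ deriv u x ≠ 0 ∧
    LinearIndependent ℝ (fun a => regMatrix lam q u x a)}

/-- `𝒲_α` at `x`, for `𝒲` of order `q + 1 ≤ α + 1`: the regular `α`-infinitesimal solutions. -/
def regTangJets {N p : ℕ} (lam : Fin p → (Fin N → ℝ) → ((Fin N → ℝ) →L[ℝ] ℝ)) {q α : ℕ}
    (h : q ≤ α) (x : ℝ) : Set (JetAt (α + 1) N) :=
  {j | jetProj (Nat.succ_le_succ h) j ∈ regJets lam q x} ∩ tangJets lam α x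

/-- The part of a set of `(α+1)`-jets that lies over the `1`-jet `σ`. -/
def jetsOver {N α : ℕ} (S : Set (JetAt (α + 1) N)) (σ : JetAt 1 N) : Set (JetAt (α + 1) N) :=
  {j ∈ S | jetProj (Nat.succ_le_succ (Nat.zero_le α)) j = σ}

/-- The dimension of a subset `Z` of a real affine space, in the sense of real algebraic geometry:
the Krull dimension of the ring of polynomial functions on `Z` (equivalently, on its Zariski
closure). It is `⊥` for the empty set. -/
def algDim {ι : Type} (Z : Set (ι → ℝ)) : WithBot ℕ∞ :=
  ringKrullDim (MvPolynomial ι ℝ ⧸ MvPolynomial.vanishingIdeal ℝ Z)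

/-- `Z` has codimension at least `K` in `Y`. -/
def CodimAtLeast {ι : Type} (K : ℕ) (Z Y : Set (ι → ℝ)) : Prop :=
  algDim Z + (K : WithBot ℕ∞) ≤ algDim Y

end

/-!
Near the base point `y`, choose a frame `X₁, …, Xₙ` of the distribution dual to constant covectors
`ξ₁, …, ξₙ`. A curve which is horizontal to order `α` satisfies `u' = ∑ₖ aₖ Xₖ(u)` to that order,
where the controls `aₖ = ξₖ(u')` have prescribed constant terms once the `1`-jet is fixed. The
Taylor series of all iterated derivatives of the coordinates along `u` solve a formal differential
system indexed by words in the frame, `f_J' = ∑ₖ aₖ f_{k :: J}` (`flow`). Hence the `α n` Taylor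
coefficients of the controls of orders `1, …, α` parametrize the horizontal jets over the `1`-jet by
polynomials, with a polynomial inverse: this set has dimension at least `α n`
(`jet_eq_jetOf`, `exists_curve_of_controls`, `X_mem_adjoin_jetOf`, `le_algDim_of_section`).

A left null vector of the regularity matrix is, up to factorials, the jet of a covector
`Ψ = ∑ₛ Ψₛ λˢ` along `u` which solves the adjoint of the linearised horizontality equation to order
`q + 1`, and it does not vanish at the base point (`exists_adjoint_solution`). By the adjoint
equation (`X_pow_dvd_derivative_pairing`), the pairings `f_J` of `Ψ` with the iterated brackets
`X_J` solve the same word system as above, and `f_J` vanishes to order `q + 2` for words `J` of one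
letter (`X_pow_dvd_flow_singleton`). The singular jets are therefore covered by the images of the
real points of finitely many ideals, in the covector at `y` normalised to have one entry `1` and in
the coefficients of the controls (`singularIdeal`, `exists_singular_point`).

It remains to bound the transcendence degree of the function field `F` of a component of such an
ideal. Since the brackets of length at most `r + 1` span, some `f_J(0)` with `|J| ≤ r + 1` is
nonzero in `F` (`exists_pairInit_ne_zero`). Let `δ` be a derivation of `F` killing the covector.
Expanding `δ f_J` in iterated integrals of the `δ aₖ` against iterated commutators
(`coeff_coeffDeriv_flow`), the equations `f_J = 0` force, for some control, `K + p` of the values of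
`δ` on its coefficients to be determined by the values on the other ones; the leading coefficients
of this expansion are rational functions of the order, with few zeros
(`card_filter_factorial_sum_eq_zero_le`, `exists_determined_controls`). A derivation of `F` killing
the other `p + α n - (K + p)` coordinates is therefore zero, so that these coordinates
generate a field over which `F` is algebraic (`card_le_of_derivation_eq_zero`), and the dimension of
the singular set is at most `α n - K` (`algDim_le_of_cover`).
-/

/-! ### Dimension of real algebraic sets -/

/-- The Krull dimension does not increase along an integral ring extension `f : A → B`. -/
theorem ringKrullDim_le_of_isIntegral {A B : Type*} [CommRing A] [CommRing B] (f : A →+* B)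
    (hf : f.IsIntegral) : ringKrullDim B ≤ ringKrullDim A := by
  algebraize [f]
  refine Order.krullDim_le_of_strictMono (PrimeSpectrum.comap f) ?_
  intro I J hIJ
  exact Ideal.IsIntegral.comap_lt_comap (R := A) (I := I.asIdeal) (J := J.asIdeal) hIJ

/-- Dimension bound for a covered set: `Z` is covered by finitely many polynomial images of real
points of ideals `I c`, and over each prime containing `I c` at most `e` elements are algebraically
independent. -/
theorem algDim_le_of_cover {ι κ C : Type} [Finite ι] [Finite κ] [Finite C] (Z : Set (ι → ℝ))
    (e : ℕ) (I : C → Ideal (MvPolynomial κ ℝ)) (Φ : ι → MvPolynomial κ ℝ)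
    (hZ : ∀ z ∈ Z, ∃ c, ∃ w : κ → ℝ, (∀ g ∈ I c, MvPolynomial.aeval w g = 0) ∧
      ∀ i, z i = MvPolynomial.aeval w (Φ i))
    (hI : ∀ c, ∀ P : Ideal (MvPolynomial κ ℝ), P.IsPrime → I c ≤ P → ∀ d,
      ∀ y : Fin d → MvPolynomial κ ℝ ⧸ P, AlgebraicIndependent ℝ y → d ≤ e) :
    algDim Z ≤ (e : WithBot ℕ∞) := by
  unfold algDim
  by_cases hsub : Subsingleton (MvPolynomial ι ℝ ⧸ MvPolynomial.vanishingIdeal ℝ Z)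
  · rw [ringKrullDim_eq_bot_of_subsingleton]; exact bot_le
  rw [not_subsingleton_iff_nontrivial] at hsub
  -- Noether normalisation bounds the dimension by a number of algebraically independent elements
  obtain ⟨d, g, ginj, gint⟩ := exists_integral_inj_algHom_of_fg ℝ
    (MvPolynomial ι ℝ ⧸ MvPolynomial.vanishingIdeal ℝ Z)
  have h1 := ringKrullDim_le_of_isIntegral _ gint
  rw [MvPolynomial.ringKrullDim_of_isNoetherianRing, ringKrullDim_eq_zero_of_field, zero_add,
    Nat.card_fin] at h1
  refine h1.trans ?_
  by_contra hlt
  have hlt : e < d := by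
    by_contra h
    exact hlt (by exact_mod_cast (not_lt.mp h))
  choose Y hY using fun i : Fin d =>
    Ideal.Quotient.mk_surjective (I := MvPolynomial.vanishingIdeal ℝ Z) (g (MvPolynomial.X i))
  -- a nonzero relation between the `d` elements, modulo each minimal prime
  have key : ∀ c, ∀ P : Ideal (MvPolynomial κ ℝ), P.IsPrime → I c ≤ P →
      ∃ G : MvPolynomial (Fin d) ℝ, G ≠ 0 ∧
        MvPolynomial.aeval (fun i => MvPolynomial.aeval Φ (Y i)) G ∈ P := by
    intro c P hP hIP
    have hni : ¬ AlgebraicIndependent ℝ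
        (fun i => Ideal.Quotient.mkₐ ℝ P (MvPolynomial.aeval Φ (Y i))) := fun h =>
      absurd (hI c P hP hIP d _ h) (not_le.mpr hlt)
    rw [algebraicIndependent_iff] at hni
    push Not at hni
    obtain ⟨G, hG, hG0⟩ := hni
    refine ⟨G, hG0, ?_⟩
    rw [← Ideal.Quotient.eq_zero_iff_mem, ← Ideal.Quotient.mkₐ_eq_mk ℝ, ← hG,
      MvPolynomial.comp_aeval_apply]
  have hfin : ∀ c, (I c).minimalPrimes.Finite := fun c =>
    Ideal.finite_minimalPrimes_of_isNoetherianRing _ (I c)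
  have : ∀ c, Fintype (I c).minimalPrimes := fun c => (hfin c).fintype
  have := Fintype.ofFinite C
  choose G hG0 hG using fun (x : Σ c, (I c).minimalPrimes) =>
    key x.1 x.2.1 x.2.2.1.1 x.2.2.1.2
  -- the product of these relations vanishes on all of `Z`
  have hprod : (∏ x, G x) ≠ 0 := Finset.prod_ne_zero_iff.mpr fun x _ => hG0 x
  apply hprod
  apply ginj
  rw [map_zero]
  have hgY : g (∏ x, G x) = Ideal.Quotient.mk _ (MvPolynomial.aeval Y (∏ x, G x)) := by
    have : g = (Ideal.Quotient.mkₐ ℝ _).comp (MvPolynomial.aeval Y) := by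
      apply MvPolynomial.algHom_ext
      intro i
      simp [hY]
    rw [this]; rfl
  rw [hgY, Ideal.Quotient.eq_zero_iff_mem, MvPolynomial.mem_vanishingIdeal_iff]
  intro z hz
  obtain ⟨c, w, hw, hzw⟩ := hZ z hz
  let Q : Ideal (MvPolynomial κ ℝ) := RingHom.ker (MvPolynomial.aeval w : MvPolynomial κ ℝ →ₐ[ℝ] ℝ)
  have hQ : Q.IsPrime := RingHom.ker_isPrime _
  obtain ⟨P, hP, hPQ⟩ := Ideal.exists_minimalPrimes_le (I := I c) (J := Q) (fun x hx => hw x hx)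
  have hmem := hPQ (hG ⟨c, ⟨P, hP⟩⟩)
  have hz' : z = fun i => MvPolynomial.aeval w (Φ i) := funext hzw
  have hcomp : ∀ f : MvPolynomial ι ℝ, MvPolynomial.aeval z f
      = MvPolynomial.aeval w (MvPolynomial.aeval Φ f) := by
    intro f
    rw [MvPolynomial.comp_aeval_apply, hz']
  rw [hcomp, map_prod, map_prod, map_prod]
  refine Finset.prod_eq_zero (Finset.mem_univ ⟨c, ⟨P, hP⟩⟩) ?_
  have : MvPolynomial.aeval Φ (MvPolynomial.aeval Y (G ⟨c, ⟨P, hP⟩⟩))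
      = MvPolynomial.aeval (fun i => MvPolynomial.aeval Φ (Y i)) (G ⟨c, ⟨P, hP⟩⟩) := by
    rw [MvPolynomial.comp_aeval_apply]
  rw [this]
  exact hmem

/-- A set containing a polynomial image of an affine space of dimension `d`, such that the
coordinate functions of the affine space are polynomials in those of the image, has dimension at
least `d`. -/
theorem le_algDim_of_section {ι κ : Type} [Finite ι] [Finite κ] (Y : Set (ι → ℝ))
    (Φ : ι → MvPolynomial κ ℝ)
    (hΦ : ∀ w : κ → ℝ, (fun i => MvPolynomial.aeval w (Φ i)) ∈ Y)
    (hX : ∀ k, MvPolynomial.X k ∈ Algebra.adjoin ℝ (Set.range Φ)) :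
    (Nat.card κ : WithBot ℕ∞) ≤ algDim Y := by
  unfold algDim
  have hker : ∀ a ∈ MvPolynomial.vanishingIdeal ℝ Y,
      (MvPolynomial.aeval Φ : MvPolynomial ι ℝ →ₐ[ℝ] MvPolynomial κ ℝ) a = 0 := by
    intro a ha
    apply MvPolynomial.funext
    intro w
    have := ha _ (hΦ w)
    rw [map_zero, ← MvPolynomial.coe_aeval_eq_eval]
    change MvPolynomial.aeval w (MvPolynomial.aeval Φ a) = 0
    rw [MvPolynomial.comp_aeval_apply]
    exact this
  have hsurj : Function.Surjective
      (Ideal.Quotient.liftₐ (MvPolynomial.vanishingIdeal ℝ Y) (MvPolynomial.aeval Φ) hker) := by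
    rw [← AlgHom.range_eq_top, eq_top_iff, ← MvPolynomial.adjoin_range_X]
    apply Algebra.adjoin_le
    rintro _ ⟨k, rfl⟩
    have h := hX k
    rw [Algebra.adjoin_range_eq_range_aeval] at h
    obtain ⟨f, hf⟩ := h
    exact ⟨Ideal.Quotient.mk _ f, hf⟩
  have := ringKrullDim_le_of_surjective _ hsurj
  rwa [MvPolynomial.ringKrullDim_of_isNoetherianRing, ringKrullDim_eq_zero_of_field,
    zero_add] at this

open scoped IntermediateField.algebraAdjoinAdjoin in
/-- In characteristic zero, a finitely generated field extension is algebraic over the subfield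
generated by `s` as soon as every derivation killing `s` is zero; so its transcendence degree is at
most `|s|`. Indeed there are then no Kähler differentials over that subfield, and an unramified
field extension is separable, in particular algebraic. -/
theorem trdeg_le_of_derivation_eq_zero {k F : Type} [Field k] [CharZero k] [Field F] [Algebra k F]
    [Algebra.EssFiniteType k F] (s : Set F)
    (h : ∀ δ : Derivation k F F, (∀ x ∈ s, δ x = 0) → δ = 0) :
    Algebra.trdeg k F ≤ Cardinal.mk s := by
  let K₀ : IntermediateField k F := IntermediateField.adjoin k s
  have : Algebra.EssFiniteType K₀ F := Algebra.EssFiniteType.of_comp k K₀ F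
  have hder : ∀ δ : Derivation K₀ F F, δ = 0 := by
    intro δ
    have h0 : δ.restrictScalars k = 0 := by
      refine h _ fun x hx => ?_
      exact δ.map_algebraMap (⟨x, IntermediateField.subset_adjoin k s hx⟩ : K₀)
    ext z
    exact DFunLike.congr_fun h0 z
  have : Algebra.FormallyUnramified K₀ F := by
    rw [Algebra.formallyUnramified_iff]
    refine ⟨fun v w => ?_⟩
    rw [← sub_eq_zero, ← Module.forall_dual_apply_eq_zero_iff F]
    intro f
    have hf : f = 0 := (KaehlerDifferential.linearMapEquivDerivation K₀ F).injective
      ((hder _).trans (hder _).symm)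
    rw [hf, LinearMap.zero_apply]
  have : Algebra.IsSeparable K₀ F := Algebra.FormallyUnramified.isSeparable K₀ F
  have : Algebra.IsAlgebraic (Algebra.adjoin k s) F := Algebra.IsAlgebraic.trans _ K₀ F
  exact Algebra.IsAlgebraic.trdeg_le_cardinalMk k s

/-- A derivation of the fraction field of a domain which vanishes on the domain is zero. -/
theorem derivation_fractionRing_eq_zero {k B F : Type*} [CommRing k] [CommRing B] [IsDomain B]
    [Field F] [Algebra k F] [Algebra B F] [IsFractionRing B F] (δ : Derivation k F F)
    (hB : ∀ b : B, δ (algebraMap B F b) = 0) : δ = 0 := by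
  ext z
  obtain ⟨a, b, hb, rfl⟩ := IsFractionRing.div_surjective (A := B) z
  have hb0 : algebraMap B F b ≠ 0 := by
    simpa using nonZeroDivisors.ne_zero hb
  have := δ.leibniz (algebraMap B F a / algebraMap B F b) (algebraMap B F b)
  rw [div_mul_cancel₀ _ hb0, hB, hB, smul_zero, zero_add, eq_comm, smul_eq_mul] at this
  simpa [hb0] using this

/-- If every derivation of the fraction field of an affine domain that kills the generators indexed
by `S` kills all generators, then at most `|S|` elements are algebraically independent. -/
theorem card_le_of_derivation_eq_zero {κ : Type} [Finite κ]
    (P : Ideal (MvPolynomial κ ℝ)) [P.IsPrime] (S : Finset κ)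
    (h : ∀ δ : Derivation ℝ (FractionRing (MvPolynomial κ ℝ ⧸ P))
        (FractionRing (MvPolynomial κ ℝ ⧸ P)),
      (∀ k ∈ S, δ (algebraMap _ _ (Ideal.Quotient.mk P (MvPolynomial.X k))) = 0) →
      ∀ k, δ (algebraMap _ _ (Ideal.Quotient.mk P (MvPolynomial.X k))) = 0)
    {d : ℕ} (y : Fin d → MvPolynomial κ ℝ ⧸ P) (hy : AlgebraicIndependent ℝ y) :
    d ≤ S.card := by
  let x : κ → FractionRing (MvPolynomial κ ℝ ⧸ P) := fun k =>
    algebraMap (MvPolynomial κ ℝ ⧸ P) _ (Ideal.Quotient.mk P (MvPolynomial.X k))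
  have : Algebra.EssFiniteType ℝ (FractionRing (MvPolynomial κ ℝ ⧸ P)) :=
    Algebra.EssFiniteType.comp ℝ (MvPolynomial κ ℝ ⧸ P) _
  have h1 : Algebra.trdeg ℝ (FractionRing (MvPolynomial κ ℝ ⧸ P)) ≤
      Cardinal.mk (x '' (S : Set κ)) := by
    refine trdeg_le_of_derivation_eq_zero _ fun δ hδ => ?_
    have h0 : ∀ k, δ (x k) = 0 := h δ fun k hk => hδ _ ⟨k, hk, rfl⟩
    refine derivation_fractionRing_eq_zero (B := MvPolynomial κ ℝ ⧸ P) δ fun b => ?_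
    obtain ⟨f, rfl⟩ := Ideal.Quotient.mk_surjective b
    induction f using MvPolynomial.induction_on with
    | C a => exact δ.map_algebraMap a
    | add p q hp hq => rw [map_add, map_add, map_add, hp, hq, add_zero]
    | mul_X p k hp =>
      rw [map_mul, map_mul, δ.leibniz, hp, smul_zero, add_zero]
      exact (congrArg _ (h0 k)).trans (smul_zero _)
  have hyF := hy.map' (f := IsScalarTower.toAlgHom ℝ (MvPolynomial κ ℝ ⧸ P)
    (FractionRing (MvPolynomial κ ℝ ⧸ P)))
    (FaithfulSMul.algebraMap_injective (MvPolynomial κ ℝ ⧸ P) _)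
  have h3 : Cardinal.mk (x '' (S : Set κ)) ≤ S.card := by
    have := Cardinal.mk_image_le (f := x) (s := (S : Set κ))
    simpa using this
  have h4 := hyF.cardinalMk_le_trdeg.trans (h1.trans h3)
  simpa using h4

/-! ### Formal flows along words -/

open PowerSeries in
/-- A power series over a real algebra without constant term, whose derivative vanishes to order
`e`, vanishes to order `e + 1`. -/
theorem X_pow_succ_dvd_of_derivative {R : Type*} [CommRing R] [Algebra ℝ R] {e : ℕ} {h : R⟦X⟧}
    (h0 : coeff 0 h = 0) (hd : (X : R⟦X⟧) ^ e ∣ d⁄dX R h) : (X : R⟦X⟧) ^ (e + 1) ∣ h := by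
  rw [X_pow_dvd_iff] at hd ⊢
  intro i hi
  cases i with
  | zero => exact h0
  | succ i =>
    have := hd i (by omega)
    rw [coeff_derivative] at this
    have h1 : ((i : ℝ) + 1) • coeff (i + 1) h = 0 := by
      rw [Algebra.smul_def, mul_comm, ← this]; simp
    have h2 : ((i : ℝ) + 1) ≠ 0 := by positivity
    rw [← inv_smul_smul₀ h2 (coeff (i + 1) h), h1, smul_zero]

open PowerSeries in
/-- The coefficients of the solution `f` of the differential system
`f_J' = ∑ₖ aₖ f_{k :: J}`, `f_J(0) = c_J`, indexed by words `J`. -/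
noncomputable def flowCoeff {n : ℕ} {R : Type*} [CommRing R] [Algebra ℝ R] (a : Fin n → R⟦X⟧)
    (c : List (Fin n) → R) : ℕ → List (Fin n) → R
  | 0, J => c J
  | e + 1, J => ((e : ℝ) + 1)⁻¹ •
      ∑ k, ∑ i : Fin (e + 1), coeff (e - i) (a k) * flowCoeff a c i (k :: J)

open PowerSeries in
/-- The formal flow with control series `a`: the solution `f` of the differential system
`f_J' = ∑ₖ aₖ f_{k :: J}`, `f_J(0) = c_J`, indexed by words `J`. If `u' = ∑ₖ aₖ Xₖ(u)` and
`c_J` is the iterated derivative along `X_J` of a function `g` at the initial point, then `f_J` is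
the Taylor series of the iterated derivative of `g` along the curve `u`. -/
noncomputable def flow {n : ℕ} {R : Type*} [CommRing R] [Algebra ℝ R] (a : Fin n → R⟦X⟧)
    (c : List (Fin n) → R) (J : List (Fin n)) : R⟦X⟧ :=
  PowerSeries.mk fun e => flowCoeff a c e J

section Flow

open PowerSeries

theorem eq_of_forall_X_pow_dvd_sub {R : Type*} [CommRing R] {f g : R⟦X⟧}
    (h : ∀ e, (X : R⟦X⟧) ^ (e + 1) ∣ f - g) : f = g := by
  ext e
  have := X_pow_dvd_iff.mp (h e) e (Nat.lt_succ_self e)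
  rwa [map_sub, sub_eq_zero] at this

variable {n : ℕ} {R : Type*} [CommRing R] [Algebra ℝ R]

theorem coeff_zero_flow (a : Fin n → R⟦X⟧) (c : List (Fin n) → R) (J : List (Fin n)) :
    coeff 0 (flow a c J) = c J := by
  simp [flow, flowCoeff]

theorem derivative_flow (a : Fin n → R⟦X⟧) (c : List (Fin n) → R) (J : List (Fin n)) :
    d⁄dX R (flow a c J) = ∑ k, a k * flow a c (k :: J) := by
  ext e
  rw [coeff_derivative, map_sum]
  have h2 : ((e : ℝ) + 1) ≠ 0 := by positivity
  have h3 : coeff (e + 1) (flow a c J) * ((e : R) + 1)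
      = ((e : ℝ) + 1) • coeff (e + 1) (flow a c J) := by
    rw [Algebra.smul_def, mul_comm]; simp
  rw [h3, flow, coeff_mk, flowCoeff, smul_inv_smul₀ h2]
  refine Finset.sum_congr rfl fun k _ => ?_
  rw [mul_comm, coeff_mul, Finset.Nat.sum_antidiagonal_eq_sum_range_succ_mk, Finset.sum_range]
  refine Finset.sum_congr rfl fun i _ => ?_
  simp only [flow, coeff_mk]
  ring

/-- Two approximate solutions of the word system with the same initial values agree to one order
more than the precision to which they solve the system. -/
theorem X_pow_succ_dvd_sub_of_system {e : ℕ} {a b : Fin n → R⟦X⟧} {f g : List (Fin n) → R⟦X⟧}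
    (hab : ∀ k, (X : R⟦X⟧) ^ e ∣ a k - b k)
    (hf : ∀ J, (X : R⟦X⟧) ^ e ∣ d⁄dX R (f J) - ∑ k, a k * f (k :: J))
    (hg : ∀ J, (X : R⟦X⟧) ^ e ∣ d⁄dX R (g J) - ∑ k, b k * g (k :: J))
    (h0 : ∀ J, coeff 0 (f J) = coeff 0 (g J)) (J : List (Fin n)) :
    (X : R⟦X⟧) ^ (e + 1) ∣ f J - g J := by
  have key : ∀ i ≤ e + 1, ∀ J, (X : R⟦X⟧) ^ i ∣ f J - g J := by
    intro i
    induction i with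
    | zero => intro _ J; simp
    | succ i ih =>
      intro hi J
      apply X_pow_succ_dvd_of_derivative (by rw [map_sub, h0, sub_self])
      have hie : (X : R⟦X⟧) ^ i ∣ X ^ e := pow_dvd_pow _ (by omega)
      have h1 : (X : R⟦X⟧) ^ i ∣ ∑ k, (a k * f (k :: J) - b k * g (k :: J)) := by
        refine Finset.dvd_sum fun k _ => ?_
        have : a k * f (k :: J) - b k * g (k :: J)
            = (a k - b k) * f (k :: J) + b k * (f (k :: J) - g (k :: J)) := by ring
        rw [this]
        exact dvd_add (Dvd.dvd.mul_right (hie.trans (hab k)) _)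
          (Dvd.dvd.mul_left (ih (by omega) _) _)
      have h2 := dvd_add (dvd_sub (hie.trans (hf J)) (hie.trans (hg J))) h1
      rw [Finset.sum_sub_distrib] at h2
      rw [map_sub]
      convert h2 using 1
      ring
  exact key _ le_rfl J

/-- Formal flows are natural in the coefficient ring. -/
theorem map_flow {R' : Type*} [CommRing R'] [Algebra ℝ R'] (φ : R →ₐ[ℝ] R') (a : Fin n → R⟦X⟧)
    (c : List (Fin n) → R) (J : List (Fin n)) :
    PowerSeries.map (φ : R →+* R') (flow a c J)
      = flow (fun k => PowerSeries.map (φ : R →+* R') (a k)) (fun J => φ (c J)) J := by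
  refine eq_of_forall_X_pow_dvd_sub fun e => ?_
  refine X_pow_succ_dvd_sub_of_system
    (f := fun J => PowerSeries.map (φ : R →+* R') (flow a c J))
    (g := flow (fun k => PowerSeries.map (φ : R →+* R') (a k)) (fun J => φ (c J)))
    (a := fun k => PowerSeries.map (φ : R →+* R') (a k))
    (b := fun k => PowerSeries.map (φ : R →+* R') (a k)) ?_ ?_ ?_ ?_ J
  · intro k; simp
  · intro J
    have : d⁄dX R' (PowerSeries.map (φ : R →+* R') (flow a c J))
        = PowerSeries.map (φ : R →+* R') (d⁄dX R (flow a c J)) := by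
      ext i
      simp [coeff_derivative]
    rw [this, derivative_flow, map_sum]
    simp
  · intro J
    rw [derivative_flow, sub_self]
    exact dvd_zero _
  · intro J
    rw [coeff_zero_flow, coeff_map, coeff_zero_flow]
    rfl

end Flow

/-! ### Variation of formal flows under derivations of the coefficient field -/

section Variation

open PowerSeries

variable {n : ℕ} {F : Type*} [Field F] [Algebra ℝ F]

/-- A derivation of the coefficients, applied to a power series. -/
noncomputable def coeffDeriv (δ : Derivation ℝ F F) : F⟦X⟧ →+ F⟦X⟧ where
  toFun f := PowerSeries.mk fun i => δ (coeff i f)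
  map_zero' := by ext; simp
  map_add' f g := by ext; simp

@[simp] theorem coeff_coeffDeriv (δ : Derivation ℝ F F) (f : F⟦X⟧) (i : ℕ) :
    coeff i (coeffDeriv δ f) = δ (coeff i f) := by simp [coeffDeriv]

theorem coeffDeriv_mul (δ : Derivation ℝ F F) (f g : F⟦X⟧) :
    coeffDeriv δ (f * g) = coeffDeriv δ f * g + f * coeffDeriv δ g := by
  ext i
  rw [coeff_coeffDeriv, coeff_mul, map_sum, map_add, coeff_mul, coeff_mul,
    ← Finset.sum_add_distrib]
  refine Finset.sum_congr rfl fun x _ => ?_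
  rw [Derivation.leibniz, coeff_coeffDeriv, coeff_coeffDeriv, smul_eq_mul, smul_eq_mul]
  ring

theorem coeffDeriv_derivative (δ : Derivation ℝ F F) (f : F⟦X⟧) :
    coeffDeriv δ (d⁄dX F f) = d⁄dX F (coeffDeriv δ f) := by
  ext i
  rw [coeff_coeffDeriv, coeff_derivative, coeff_derivative, coeff_coeffDeriv, Derivation.leibniz]
  have : δ ((i : F) + 1) = 0 := by
    have := δ.map_natCast (i + 1)
    rwa [Nat.cast_succ] at this
  rw [this, smul_zero, zero_add, smul_eq_mul, mul_comm]

/-- Formal integration from `0`. -/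
noncomputable def integ {F : Type*} [Field F] (f : F⟦X⟧) : F⟦X⟧ :=
  PowerSeries.mk fun i => (i : F)⁻¹ * coeff (i - 1) f

theorem coeff_zero_integ {F : Type*} [Field F] (f : F⟦X⟧) : coeff 0 (integ f) = 0 := by simp [integ]

theorem coeff_succ_integ {F : Type*} [Field F] (f : F⟦X⟧) (i : ℕ) :
    coeff (i + 1) (integ f) = ((i : F) + 1)⁻¹ * coeff i f := by simp [integ]

theorem derivative_integ (f : F⟦X⟧) : d⁄dX F (integ f) = f := by
  have : CharZero F := charZero_of_injective_algebraMap (algebraMap ℝ F).injective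
  ext i
  rw [coeff_derivative, coeff_succ_integ]
  have : (i : F) + 1 ≠ 0 := by exact_mod_cast Nat.succ_ne_zero i
  field_simp

theorem X_pow_dvd_integ_iterate {m : ℕ} {f : F⟦X⟧} (h : (X : F⟦X⟧) ^ m ∣ f) (j : ℕ) :
    (X : F⟦X⟧) ^ (m + j) ∣ integ^[j] f := by
  induction j with
  | zero => exact h
  | succ j ih =>
    rw [Function.iterate_succ_apply']
    apply X_pow_succ_dvd_of_derivative (coeff_zero_integ _)
    rwa [derivative_integ]

theorem coeff_integ_iterate (m : ℕ) (f : F⟦X⟧) (j : ℕ) :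
    coeff (m + j) (integ^[j] f) = (m.factorial : F) / ((m + j).factorial : F) * coeff m f := by
  have : CharZero F := charZero_of_injective_algebraMap (algebraMap ℝ F).injective
  have hne : ∀ k : ℕ, (k.factorial : F) ≠ 0 := fun k => by exact_mod_cast k.factorial_ne_zero
  induction j with
  | zero => simp [hne]
  | succ j ih =>
    rw [Function.iterate_succ_apply', ← add_assoc, coeff_succ_integ, ih, Nat.factorial_succ]
    have h1 : ((m + j : ℕ) : F) + 1 ≠ 0 := by
      exact_mod_cast Nat.succ_ne_zero (m + j)
    have h2 := hne (m + j)
    push_cast at h1 ⊢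
    field_simp

theorem coeff_add_mul_of_X_pow_dvd {R : Type*} [CommRing R] {p q : ℕ} {f g : R⟦X⟧}
    (hf : (X : R⟦X⟧) ^ p ∣ f) (hg : (X : R⟦X⟧) ^ q ∣ g) :
    coeff (p + q) (f * g) = coeff p f * coeff q g := by
  obtain ⟨f, rfl⟩ := hf
  obtain ⟨g, rfl⟩ := hg
  have h : (X : R⟦X⟧) ^ p * f * (X ^ q * g) = X ^ (p + q) * (f * g) := by rw [pow_add]; ring
  have h0 : ∀ (r : ℕ) (φ : R⟦X⟧), coeff r ((X : R⟦X⟧) ^ r * φ) = coeff 0 φ := fun r φ => by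
    simpa using coeff_X_pow_mul φ r 0
  rw [h, h0, h0, h0]
  simp

/-- The tower of commutators `E_j = ad^j(E_0)` of the operator `f ↦ ∑ᵢ aᵢ f_{i :: ·} - f'` with the
shift `E_0 = f_{k :: ·}`. For an exact flow, `E_{j,J}` is the pairing of the transported covector
with the bracket of `ad^j Xₖ` and `X_J`. -/
noncomputable def commTower (a : Fin n → F⟦X⟧) (f : List (Fin n) → F⟦X⟧) (k : Fin n) :
    ℕ → List (Fin n) → F⟦X⟧
  | 0, J => f (k :: J)
  | j + 1, J => ∑ i, a i * commTower a f k j (i :: J) - d⁄dX F (commTower a f k j J)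

/-- Repeated integration by parts: the first `M` terms of the expansion of the variation of a flow
in iterated integrals of the variation of the controls solve the linearised system up to a
remainder. -/
theorem derivative_sum_integ_mul_commTower (a b : Fin n → F⟦X⟧) (f : List (Fin n) → F⟦X⟧)
    (M : ℕ) (J : List (Fin n)) :
    d⁄dX F (∑ j ∈ Finset.range M, ∑ k, integ^[j + 1] (b k) * commTower a f k j J)
      = ∑ i, a i * (∑ j ∈ Finset.range M, ∑ k,
          integ^[j + 1] (b k) * commTower a f k j (i :: J))
        + ∑ k, b k * f (k :: J) - ∑ k, integ^[M] (b k) * commTower a f k M J := by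
  induction M with
  | zero => simp [commTower]
  | succ M ih =>
    rw [Finset.sum_range_succ, map_add, ih]
    simp only [Finset.sum_range_succ, mul_add, Finset.sum_add_distrib, map_sum,
      Derivation.leibniz, smul_eq_mul, Function.iterate_succ_apply', derivative_integ]
    simp only [commTower, mul_sub, Finset.sum_sub_distrib]
    have : ∑ i, a i * ∑ k, integ (integ^[M] (b k)) * commTower a f k M (i :: J)
        = ∑ k, integ (integ^[M] (b k)) * ∑ i, a i * commTower a f k M (i :: J) := by
      simp only [Finset.mul_sum]
      rw [Finset.sum_comm]
      refine Finset.sum_congr rfl fun _ _ => Finset.sum_congr rfl fun _ _ => by ring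
    rw [this]
    simp only [mul_comm (commTower a f _ M J)]
    ring

/-- Expansion of the variation of a flow whose controls vary to order `m`. -/
theorem X_pow_dvd_coeffDeriv_sub {a : Fin n → F⟦X⟧} {f : List (Fin n) → F⟦X⟧}
    (hf : ∀ J, d⁄dX F (f J) = ∑ k, a k * f (k :: J)) (δ : Derivation ℝ F F)
    (h0 : ∀ J, δ (coeff 0 (f J)) = 0) {m : ℕ} (hm : ∀ k, (X : F⟦X⟧) ^ m ∣ coeffDeriv δ (a k))
    (M : ℕ) (J : List (Fin n)) :
    (X : F⟦X⟧) ^ (m + M + 1) ∣ coeffDeriv δ (f J) -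
      ∑ j ∈ Finset.range M, ∑ k, integ^[j + 1] (coeffDeriv δ (a k)) * commTower a f k j J := by
  have h := X_pow_succ_dvd_sub_of_system (e := m + M) (a := a) (b := a)
    (f := fun J => coeffDeriv δ (f J) - ∑ j ∈ Finset.range M, ∑ k,
      integ^[j + 1] (coeffDeriv δ (a k)) * commTower a f k j J)
    (g := fun _ => 0) ?_ ?_ ?_ ?_ J
  · simpa using h
  · intro k; simp
  · intro J
    rw [map_sub, derivative_sum_integ_mul_commTower, ← coeffDeriv_derivative, hf, map_sum]
    simp only [coeffDeriv_mul, mul_sub, Finset.sum_sub_distrib, Finset.sum_add_distrib]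
    have : ∀ A B C D : F⟦X⟧, A + B - (C + A - D) - (B - C) = D := fun A B C D => by ring
    rw [this]
    exact Finset.dvd_sum fun k _ => Dvd.dvd.mul_right (X_pow_dvd_integ_iterate (hm k) M) _
  · intro J; simp
  · intro J
    simp only [map_sub, map_sum, map_zero, coeff_coeffDeriv, h0, zero_sub, neg_eq_zero]
    refine Finset.sum_eq_zero fun j _ => Finset.sum_eq_zero fun k _ => ?_
    rw [Function.iterate_succ_apply', coeff_zero_eq_constantCoeff_apply, map_mul,
      ← coeff_zero_eq_constantCoeff_apply, coeff_zero_integ, zero_mul]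

/-- Leading coefficient of the variation of a flow, when the commutator tower at `J` vanishes to
total order `l`. -/
theorem coeff_coeffDeriv_flow {a : Fin n → F⟦X⟧} {f : List (Fin n) → F⟦X⟧}
    (hf : ∀ J, d⁄dX F (f J) = ∑ k, a k * f (k :: J)) (δ : Derivation ℝ F F)
    (h0 : ∀ J, δ (coeff 0 (f J)) = 0) {m : ℕ} (hm : ∀ k, (X : F⟦X⟧) ^ m ∣ coeffDeriv δ (a k))
    {l : ℕ} {J : List (Fin n)}
    (hl : ∀ k, ∀ j ≤ l, (X : F⟦X⟧) ^ (l - j) ∣ commTower a f k j J) :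
    δ (coeff (m + l + 1) (f J)) = ∑ k, δ (coeff m (a k)) *
      ∑ j ∈ Finset.range (l + 1), (m.factorial : F) / ((m + (j + 1)).factorial : F)
        * coeff (l - j) (commTower a f k j J) := by
  have h := X_pow_dvd_coeffDeriv_sub hf δ h0 hm (l + 1) J
  have h1 := X_pow_dvd_iff.mp h (m + l + 1) (by omega)
  rw [map_sub, sub_eq_zero, coeff_coeffDeriv] at h1
  rw [h1, map_sum]
  simp only [map_sum, Finset.mul_sum]
  rw [Finset.sum_comm]
  refine Finset.sum_congr rfl fun k _ => Finset.sum_congr rfl fun j hj => ?_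
  have hj : j ≤ l := by simpa [Nat.lt_succ_iff] using hj
  have h2 : m + l + 1 = (m + (j + 1)) + (l - j) := by omega
  rw [h2, coeff_add_mul_of_X_pow_dvd (X_pow_dvd_integ_iterate (hm k) (j + 1)) (hl k j hj),
    coeff_integ_iterate, coeff_coeffDeriv]
  ring

theorem prod_Ico_mul_factorial {F : Type*} [Field F] (m j d : ℕ) :
    (∏ i ∈ Finset.Ico j (j + d), ((m : F) + ((i : F) + 1))) * ((m + j).factorial : F)
      = ((m + (j + d)).factorial : F) := by
  induction d with
  | zero => simp
  | succ d ih =>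
    rw [← add_assoc, Finset.prod_Ico_succ_top (by omega), mul_right_comm, ih,
      show m + (j + d + 1) = m + (j + d) + 1 from rfl, Nat.factorial_succ]
    push_cast
    ring

/-- The rational function `m ↦ ∑ⱼ m! / (m + j + 1)! vⱼ`, `0 ≤ j ≤ l`, has at most `l` natural zeros
unless all `vⱼ` vanish. -/
theorem card_filter_factorial_sum_eq_zero_le {l : ℕ} (v : ℕ → F) (hv : ∃ j ≤ l, v j ≠ 0)
    (T : Finset ℕ)
    (hT : ∀ m ∈ T, ∑ j ∈ Finset.range (l + 1),
      (m.factorial : F) / ((m + (j + 1)).factorial : F) * v j = 0) : T.card ≤ l := by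
  classical
  have : CharZero F := charZero_of_injective_algebraMap (algebraMap ℝ F).injective
  have hne : ∀ k : ℕ, (k.factorial : F) ≠ 0 := fun k => by exact_mod_cast k.factorial_ne_zero
  -- `Q j` is the polynomial with `Q j (m) = (m + l + 1)! / (m + j + 1)!`
  let Q : ℕ → Polynomial F := fun j =>
    ∏ i ∈ Finset.Ico (j + 1) (l + 1), (Polynomial.X + Polynomial.C ((i : F) + 1))
  have hQm : ∀ j, (Q j).Monic := fun j =>
    Polynomial.monic_prod_of_monic _ _ fun i _ => Polynomial.monic_X_add_C _
  have hQd : ∀ j, (Q j).natDegree = l - j := fun j => by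
    rw [Polynomial.natDegree_prod_of_monic _ _ fun i _ => Polynomial.monic_X_add_C _]
    simp only [Polynomial.natDegree_X_add_C, Finset.sum_const, Nat.card_Ico, smul_eq_mul]
    omega
  have hQe : ∀ j ≤ l, ∀ m : ℕ, (Q j).eval (m : F) * ((m + (j + 1)).factorial : F)
      = ((m + (l + 1)).factorial : F) := by
    intro j hj m
    obtain ⟨d, rfl⟩ := Nat.exists_eq_add_of_le hj
    have := prod_Ico_mul_factorial (F := F) m (j + 1) d
    simpa [Q, Polynomial.eval_prod, add_assoc, add_comm, add_left_comm] using this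
  let P : Polynomial F := ∑ j ∈ Finset.range (l + 1), Polynomial.C (v j) * Q j
  have hPd : P.natDegree ≤ l := by
    refine Polynomial.natDegree_sum_le_of_forall_le _ _ fun j _ => ?_
    refine (Polynomial.natDegree_C_mul_le _ _).trans ?_
    rw [hQd]; omega
  have hP0 : P ≠ 0 := by
    intro hP
    -- the `Q j` have distinct degrees: the first `j` with `v j ≠ 0` gives the leading term
    have hex : ∃ j, v j ≠ 0 := let ⟨j, _, h⟩ := hv; ⟨j, h⟩
    have hle : Nat.find hex ≤ l := let ⟨j, hj, h⟩ := hv; (Nat.find_min' hex h).trans hj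
    have hc := congrArg (fun p => Polynomial.coeff p (l - Nat.find hex)) hP
    simp only [P, Polynomial.finsetSum_coeff, Polynomial.coeff_C_mul, Polynomial.coeff_zero] at hc
    rw [Finset.sum_eq_single (Nat.find hex)] at hc
    · have := hQm (Nat.find hex)
      rw [Polynomial.Monic, Polynomial.leadingCoeff, hQd] at this
      rw [this, mul_one] at hc
      exact Nat.find_spec hex hc
    · intro j hj hne
      rcases lt_or_gt_of_ne hne with h | h
      · rw [not_not.mp (Nat.find_min hex h), zero_mul]
      · rw [Polynomial.coeff_eq_zero_of_natDegree_lt, mul_zero]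
        rw [hQd]
        have : j ≤ l := by simpa [Nat.lt_succ_iff] using hj
        omega
    · intro h
      exact absurd (Finset.mem_range.mpr (Nat.lt_succ_of_le hle)) h
  have hroot : ∀ m ∈ T, (m : F) ∈ P.roots.toFinset := by
    intro m hm
    rw [Multiset.mem_toFinset, Polynomial.mem_roots hP0, Polynomial.IsRoot]
    have h1 := hT m hm
    have h2 : P.eval (m : F) = ((m + (l + 1)).factorial : F) / (m.factorial : F) *
        ∑ j ∈ Finset.range (l + 1),
          (m.factorial : F) / ((m + (j + 1)).factorial : F) * v j := by
      rw [Polynomial.eval_finsetSum, Finset.mul_sum]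
      refine Finset.sum_congr rfl fun j hj => ?_
      have hj : j ≤ l := by simpa [Nat.lt_succ_iff] using hj
      rw [Polynomial.eval_mul, Polynomial.eval_C, ← hQe j hj m]
      have := hne m
      have := hne (m + (j + 1))
      field_simp
    rw [h2, h1, mul_zero]
  calc T.card ≤ P.roots.toFinset.card :=
        Finset.card_le_card_of_injOn (fun m : ℕ => (m : F)) hroot (Nat.cast_injective.injOn)
    _ ≤ P.roots.card := Multiset.toFinset_card_le _
    _ ≤ P.natDegree := Polynomial.card_roots' _
    _ ≤ l := hPd

/-- An order of vanishing sufficient for `exists_determined_controls`, in terms of the number `K` of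
coefficients to be determined and of the number of extra letters of the nonvanishing word. In the
recursion from `B` to `2 B + K`, a commutator which is nonzero in order `l < B` shifts the orders
of the controls by `l + 1` and has at most `l` exceptional orders, which leaves `K` of them. -/
def depthBound (K : ℕ) : ℕ → ℕ
  | 0 => 1
  | T + 1 => 2 * depthBound K T + K

theorem one_le_depthBound (K T : ℕ) : 1 ≤ depthBound K T := by
  induction T with
  | zero => exact le_rfl
  | succ T ih => rw [depthBound]; omega

/-- **Rigidity of singular controls.** If all series `f_J` with `|J| = s` vanish to a high order but
some `f_J` with `s ≤ |J| ≤ s + T` is nonzero at the origin, then at least `K` coefficients of one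
of the controls are determined, infinitesimally, by the remaining coefficients and the initial
values. The induction is on `T`: either some entry of the commutator tower at a word of length `s`
is nonzero to low order, and then the lowest terms of the variation of `f_J = 0` determine the
coefficients, or the entries `f_{k :: J}` of the tower vanish to low order, and `s` increases. -/
theorem exists_determined_controls {a : Fin n → F⟦X⟧} {f : List (Fin n) → F⟦X⟧}
    (hf : ∀ J, d⁄dX F (f J) = ∑ k, a k * f (k :: J)) (K T : ℕ) (s : ℕ)
    (hs : ∀ J : List (Fin n), J.length = s → (X : F⟦X⟧) ^ depthBound K T ∣ f J)
    (hJ : ∃ J : List (Fin n), s ≤ J.length ∧ J.length ≤ s + T ∧ coeff 0 (f J) ≠ 0) :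
    ∃ (k : Fin n) (S : Finset ℕ), K ≤ S.card ∧ (∀ m ∈ S, 1 ≤ m ∧ m + 1 < depthBound K T) ∧
      ∀ δ : Derivation ℝ F F, (∀ J, δ (coeff 0 (f J)) = 0) →
        (∀ k' m, k' ≠ k ∨ m ∉ S → δ (coeff m (a k')) = 0) →
        ∀ m ∈ S, δ (coeff m (a k)) = 0 := by
  classical
  induction T generalizing s with
  | zero =>
    obtain ⟨J, h1, h2, h3⟩ := hJ
    have := X_pow_dvd_iff.mp (hs J (by omega)) 0 (by simp [depthBound])
    exact absurd this h3
  | succ T ih =>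
    have hB := one_le_depthBound K T
    set B := depthBound K T with hBdef
    by_cases hcase : ∃ l, l < B ∧ ∃ J : List (Fin n), J.length = s ∧ ∃ k, ∃ j ≤ l,
        coeff (l - j) (commTower a f k j J) ≠ 0
    · obtain ⟨hlB, J, hJs, k, j₀, hj₀, hne⟩ := Nat.find_spec hcase
      set l := Nat.find hcase with hldef
      have hl : ∀ k, ∀ j ≤ l, (X : F⟦X⟧) ^ (l - j) ∣ commTower a f k j J := by
        intro k j hj
        rw [X_pow_dvd_iff]
        intro i hi
        by_contra h
        refine Nat.find_min hcase (m := i + j) (by omega) ⟨by omega, J, hJs, k, j, by omega, ?_⟩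
        simpa using h
      -- by minimality of `l`, `c m` is the leading coefficient of the variation of `f_J` caused by
      -- a variation of the coefficient of order `m` of the control `a k`
      let c : ℕ → F := fun m => ∑ j ∈ Finset.range (l + 1),
        (m.factorial : F) / ((m + (j + 1)).factorial : F)
          * coeff (l - j) (commTower a f k j J)
      let I : Finset ℕ := Finset.Ico 1 (2 * B + K - l - 1)
      let bad : Finset ℕ := I.filter fun m => c m = 0
      have hbad : bad.card ≤ l := by
        refine card_filter_factorial_sum_eq_zero_le
          (fun j => coeff (l - j) (commTower a f k j J)) ⟨j₀, hj₀, hne⟩ bad fun m hm => ?_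
        exact (Finset.mem_filter.mp hm).2
      refine ⟨k, I \ bad, ?_, ?_, ?_⟩
      · have h1 := Finset.le_card_sdiff bad I
        have h2 : I.card = 2 * B + K - l - 1 - 1 := Nat.card_Ico _ _
        omega
      · intro m hm
        have := (Finset.mem_sdiff.mp hm).1
        rw [Finset.mem_Ico] at this
        rw [depthBound]
        omega
      · intro δ hδ0 hδ
        have key : ∀ m, m < 2 * B + K - l - 1 → ∀ k', δ (coeff m (a k')) = 0 := by
          intro m
          induction m using Nat.strong_induction_on with
          | _ m IH =>
          intro hm k'
          by_cases hk : k' ≠ k ∨ m ∉ I \ bad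
          · exact hδ k' m hk
          · push Not at hk
            obtain ⟨rfl, hmS⟩ := hk
            have hdvd : ∀ k'', (X : F⟦X⟧) ^ m ∣ coeffDeriv δ (a k'') := by
              intro k''
              rw [X_pow_dvd_iff]
              intro i hi
              rw [coeff_coeffDeriv]
              exact IH i hi (by omega) k''
            have h1 := coeff_coeffDeriv_flow hf δ hδ0 hdvd hl
            have h2 : coeff (m + l + 1) (f J) = 0 := by
              refine X_pow_dvd_iff.mp (hs J hJs) _ ?_
              rw [depthBound]
              omega
            rw [h2, map_zero, Finset.sum_eq_single k'] at h1
            · have hc : c m ≠ 0 := by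
                intro h
                rw [Finset.mem_sdiff] at hmS
                exact hmS.2 (Finset.mem_filter.mpr ⟨hmS.1, h⟩)
              exact (mul_eq_zero.mp h1.symm).resolve_right hc
            · intro k'' _ hk''
              rw [hδ k'' m (Or.inl hk''), zero_mul]
            · intro h
              exact absurd (Finset.mem_univ _) h
        intro m hm
        have := (Finset.mem_sdiff.mp hm).1
        rw [Finset.mem_Ico] at this
        exact key m this.2 k
    · push Not at hcase
      have hstep : ∀ J : List (Fin n), J.length = s + 1 → (X : F⟦X⟧) ^ B ∣ f J := by
        intro J hJ
        match J, hJ with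
        | k :: J, hJ =>
          rw [X_pow_dvd_iff]
          intro i hi
          exact hcase i hi J (by simpa using hJ) k 0 (Nat.zero_le _)
      obtain ⟨J, h1, h2, h3⟩ := hJ
      have hJne : J.length ≠ s := by
        intro h
        refine h3 (X_pow_dvd_iff.mp (hs J h) 0 ?_)
        exact one_le_depthBound K (T + 1)
      obtain ⟨k, S, hS, hS', hδ⟩ := ih (s + 1) hstep ⟨J, by omega, by omega, h3⟩
      refine ⟨k, S, hS, fun m hm => ?_, hδ⟩
      obtain ⟨h4, h5⟩ := hS' m hm
      refine ⟨h4, ?_⟩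
      rw [depthBound]
      omega

end Variation

/-! ### Taylor series of smooth functions along a curve -/

section Taylor

open PowerSeries Filter Topology

/-- The Taylor series at `x` of a function `ℝ → ℝ`. -/
noncomputable def taylorAt (x : ℝ) (g : ℝ → ℝ) : ℝ⟦X⟧ :=
  PowerSeries.mk fun i => iteratedDeriv i g x / i.factorial

theorem coeff_taylorAt (x : ℝ) (g : ℝ → ℝ) (i : ℕ) :
    coeff i (taylorAt x g) = iteratedDeriv i g x / i.factorial := by simp [taylorAt]

theorem iteratedDeriv_eq_coeff_taylorAt (x : ℝ) (g : ℝ → ℝ) (i : ℕ) :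
    iteratedDeriv i g x = i.factorial * coeff i (taylorAt x g) := by
  rw [coeff_taylorAt, mul_div_cancel₀]
  exact_mod_cast i.factorial_ne_zero

theorem coeff_zero_taylorAt (x : ℝ) (g : ℝ → ℝ) : coeff 0 (taylorAt x g) = g x := by
  simp [coeff_taylorAt]

theorem taylorAt_congr {x : ℝ} {f g : ℝ → ℝ} (h : f =ᶠ[𝓝 x] g) : taylorAt x f = taylorAt x g := by
  ext i
  rw [coeff_taylorAt, coeff_taylorAt, (h.iteratedDeriv i).eq_of_nhds]

theorem taylorAt_const (x c : ℝ) : taylorAt x (fun _ => c) = C c := by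
  ext i
  rw [coeff_taylorAt, iteratedDeriv_const, coeff_C]
  split_ifs with h <;> simp [h]

theorem taylorAt_add {x : ℝ} {f g : ℝ → ℝ} (hf : ContDiffAt ℝ ∞ f x) (hg : ContDiffAt ℝ ∞ g x) :
    taylorAt x (fun t => f t + g t) = taylorAt x f + taylorAt x g := by
  ext i
  rw [map_add, coeff_taylorAt, coeff_taylorAt, coeff_taylorAt, iteratedDeriv_fun_add
    (hf.of_le (by exact_mod_cast le_top)) (hg.of_le (by exact_mod_cast le_top)), add_div]

theorem taylorAt_sum {ι : Type*} (s : Finset ι) {x : ℝ} {f : ι → ℝ → ℝ}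
    (hf : ∀ i ∈ s, ContDiffAt ℝ ∞ (f i) x) :
    taylorAt x (fun t => ∑ i ∈ s, f i t) = ∑ i ∈ s, taylorAt x (f i) := by
  ext k
  rw [map_sum, coeff_taylorAt, iteratedDeriv_fun_sum
    (fun i hi => (hf i hi).of_le (by exact_mod_cast le_top)), Finset.sum_div]
  simp only [coeff_taylorAt]

theorem taylorAt_mul {x : ℝ} {f g : ℝ → ℝ} (hf : ContDiffAt ℝ ∞ f x) (hg : ContDiffAt ℝ ∞ g x) :
    taylorAt x (fun t => f t * g t) = taylorAt x f * taylorAt x g := by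
  ext i
  rw [coeff_mul, coeff_taylorAt, iteratedDeriv_fun_mul
    (hf.of_le (by exact_mod_cast le_top)) (hg.of_le (by exact_mod_cast le_top)),
    Finset.Nat.sum_antidiagonal_eq_sum_range_succ_mk, Finset.sum_div]
  refine Finset.sum_congr rfl fun k hk => ?_
  have hk : k ≤ i := by simpa [Nat.lt_succ_iff] using hk
  rw [coeff_taylorAt, coeff_taylorAt, Nat.cast_choose ℝ hk]
  have h1 : (k.factorial : ℝ) ≠ 0 := by exact_mod_cast k.factorial_ne_zero
  have h2 : ((i - k).factorial : ℝ) ≠ 0 := by exact_mod_cast (i - k).factorial_ne_zero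
  have h3 : (i.factorial : ℝ) ≠ 0 := by exact_mod_cast i.factorial_ne_zero
  field_simp

theorem derivative_taylorAt (x : ℝ) (g : ℝ → ℝ) :
    d⁄dX ℝ (taylorAt x g) = taylorAt x (deriv g) := by
  ext i
  rw [coeff_derivative, coeff_taylorAt, coeff_taylorAt, iteratedDeriv_succ', Nat.factorial_succ]
  have h3 : (i.factorial : ℝ) ≠ 0 := by exact_mod_cast i.factorial_ne_zero
  have h4 : (i : ℝ) + 1 ≠ 0 := by positivity
  push_cast
  field_simp

theorem taylorAt_polynomial (x : ℝ) (P : Polynomial ℝ) :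
    taylorAt x (fun t => P.eval (t - x)) = (P : ℝ⟦X⟧) := by
  have hs : ∀ P : Polynomial ℝ, ContDiffAt ℝ ∞ (fun t => P.eval (t - x)) x := fun P => by
    have h := (P.contDiff_aeval (𝕜 := ℝ) ∞).comp
      (contDiff_id.sub (contDiff_const (c := x)))
    exact h.contDiffAt
  have hX : taylorAt x (fun t => t - x) = X := by
    have h0 : coeff 0 (taylorAt x (fun t => t - x)) = 0 := by simp [coeff_zero_taylorAt]
    apply derivative.ext
    · rw [derivative_taylorAt, derivative_X]
      have : deriv (fun t => t - x) = fun _ => (1 : ℝ) := by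
        ext t; simp
      rw [this, taylorAt_const, map_one]
    · simpa using h0
  induction P using Polynomial.induction_on with
  | C a => simp [taylorAt_const]
  | add p q hp hq =>
    simp only [Polynomial.eval_add, Polynomial.coe_add]
    rw [taylorAt_add (hs p) (hs q), hp, hq]
  | monomial m a h =>
    have : (fun t => (Polynomial.C a * Polynomial.X ^ (m + 1)).eval (t - x))
        = fun t => (Polynomial.C a * Polynomial.X ^ m).eval (t - x) * (t - x) := by
      ext t; simp [pow_succ, mul_assoc]
    rw [this, taylorAt_mul (hs _) (by fun_prop), h, hX, pow_succ, ← mul_assoc]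
    simp

theorem X_pow_dvd_taylorAt_iff {x : ℝ} {g : ℝ → ℝ} {e : ℕ} :
    (X : ℝ⟦X⟧) ^ e ∣ taylorAt x g ↔ ∀ i < e, iteratedDeriv i g x = 0 := by
  rw [X_pow_dvd_iff]
  refine forall₂_congr fun i _ => ?_
  rw [coeff_taylorAt, div_eq_zero_iff]
  have : (i.factorial : ℝ) ≠ 0 := by exact_mod_cast i.factorial_ne_zero
  tauto

theorem iteratedDeriv_apply_of_contDiffAt {ι : Type*} [Fintype ι] {u : ℝ → ι → ℝ} {x : ℝ}
    (hu : ContDiffAt ℝ ∞ u x) (i : ℕ) (μ : ι) :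
    iteratedDeriv i u x μ = iteratedDeriv i (fun t => u t μ) x := by
  rw [iteratedDeriv_eq_iteratedFDeriv, iteratedDeriv_eq_iteratedFDeriv]
  have h := (ContinuousLinearMap.proj (R := ℝ) (φ := fun _ : ι => ℝ) μ).iteratedFDeriv_comp_left
    (f := u) (x := x) hu (i := i) (by exact_mod_cast le_top)
  exact (congrArg (fun T => T fun _ => (1 : ℝ)) h).symm

theorem ContDiffAt.deriv_of_infty {E : Type*} [NormedAddCommGroup E] [NormedSpace ℝ E]
    {g : ℝ → E} {x : ℝ} (hg : ContDiffAt ℝ ∞ g x) : ContDiffAt ℝ ∞ (deriv g) x := by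
  have : deriv g = fun t => fderiv ℝ g t 1 := by ext; simp
  rw [this]
  exact (hg.fderiv_right (m := ∞) (by simp)).clm_apply contDiffAt_const

theorem ContinuousLinearMap.apply_eq_sum_single {N : ℕ} (A : (Fin N → ℝ) →L[ℝ] ℝ)
    (v : Fin N → ℝ) : A v = ∑ μ, A (Pi.single μ 1) * v μ := by
  conv_lhs => rw [← Finset.univ_sum_single v]
  rw [map_sum]
  refine Finset.sum_congr rfl fun μ _ => ?_
  have : (Pi.single μ (v μ) : Fin N → ℝ) = v μ • Pi.single μ 1 := by
    rw [← Pi.single_smul', smul_eq_mul, mul_one]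
  rw [this, map_smul, smul_eq_mul, mul_comm]

/-- Taylor series of a covector field applied to a vector field, along a curve. -/
theorem taylorAt_clm_apply {N : ℕ} {x : ℝ} {A : ℝ → (Fin N → ℝ) →L[ℝ] ℝ} {v : ℝ → Fin N → ℝ}
    (hA : ContDiffAt ℝ ∞ A x) (hv : ContDiffAt ℝ ∞ v x) :
    taylorAt x (fun t => A t (v t))
      = ∑ μ, taylorAt x (fun t => A t (Pi.single μ 1)) * taylorAt x (fun t => v t μ) := by
  have h1 : ∀ μ, ContDiffAt ℝ ∞ (fun t => A t (Pi.single μ 1)) x := fun μ =>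
    hA.clm_apply contDiffAt_const
  have h2 : ∀ μ, ContDiffAt ℝ ∞ (fun t => v t μ) x := fun μ => contDiffAt_pi.mp hv μ
  have : (fun t => A t (v t)) = fun t => ∑ μ, A t (Pi.single μ 1) * v t μ := by
    ext t; exact (A t).apply_eq_sum_single _
  rw [this, taylorAt_sum _ fun μ _ => (h1 μ).mul (h2 μ)]
  exact Finset.sum_congr rfl fun μ _ => taylorAt_mul (h1 μ) (h2 μ)

variable {n N : ℕ}

/-- Chain rule along a curve whose velocity is, to order `e`, the combination of the vector fields
`X k` with coefficients `a k`. -/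
theorem X_pow_dvd_derivative_taylorAt_comp {V : Set (Fin N → ℝ)} (hV : IsOpen V)
    {X' : Fin n → (Fin N → ℝ) → (Fin N → ℝ)} (hX : ∀ k, ContDiffOn ℝ ∞ (X' k) V)
    {u : ℝ → Fin N → ℝ} (hu : ContDiff ℝ ∞ u) {x : ℝ} (hx : u x ∈ V) {a : Fin n → ℝ⟦X⟧} {e : ℕ}
    (ha : ∀ μ, (X : ℝ⟦X⟧) ^ e ∣
      taylorAt x (fun t => deriv u t μ) - ∑ k, a k * taylorAt x (fun t => X' k (u t) μ))
    {G : (Fin N → ℝ) → ℝ} (hG : ContDiffOn ℝ ∞ G V) :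
    (X : ℝ⟦X⟧) ^ e ∣ d⁄dX ℝ (taylorAt x fun t => G (u t)) -
      ∑ k, a k * taylorAt x (fun t => fderiv ℝ G (u t) (X' k (u t))) := by
  have hGx : ContDiffAt ℝ ∞ G (u x) := hG.contDiffAt (hV.mem_nhds hx)
  have hu' : ContDiffAt ℝ ∞ u x := hu.contDiffAt
  have hA : ContDiffAt ℝ ∞ (fun t => fderiv ℝ G (u t)) x :=
    (hGx.fderiv_right (m := ∞) (by simp)).comp x hu'
  have hXx : ∀ k, ContDiffAt ℝ ∞ (fun t => X' k (u t)) x := fun k =>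
    ((hX k).contDiffAt (hV.mem_nhds hx)).comp x hu'
  have hev : ∀ᶠ t in 𝓝 x, u t ∈ V := hu.continuous.continuousAt (hV.mem_nhds hx)
  have h1 : d⁄dX ℝ (taylorAt x fun t => G (u t)) =
      ∑ μ, taylorAt x (fun t => fderiv ℝ G (u t) (Pi.single μ 1))
        * taylorAt x (fun t => deriv u t μ) := by
    rw [derivative_taylorAt, ← taylorAt_clm_apply hA hu'.deriv_of_infty]
    apply taylorAt_congr
    filter_upwards [hev] with t ht
    have hGt : DifferentiableAt ℝ G (u t) :=
      (hG.contDiffAt (hV.mem_nhds ht)).differentiableAt (by simp)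
    have hut : DifferentiableAt ℝ u t := hu.contDiffAt.differentiableAt (by simp)
    exact fderiv_comp_deriv t hGt hut
  have h2 : ∑ k, a k * taylorAt x (fun t => fderiv ℝ G (u t) (X' k (u t)))
      = ∑ μ, taylorAt x (fun t => fderiv ℝ G (u t) (Pi.single μ 1)) *
        ∑ k, a k * taylorAt x (fun t => X' k (u t) μ) := by
    simp only [Finset.mul_sum]
    rw [Finset.sum_comm]
    refine Finset.sum_congr rfl fun k _ => ?_
    rw [taylorAt_clm_apply hA (hXx k), Finset.mul_sum]
    exact Finset.sum_congr rfl fun μ _ => by ring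
  rw [h1, h2, ← Finset.sum_sub_distrib]
  refine Finset.dvd_sum fun μ _ => ?_
  rw [← mul_sub]
  exact Dvd.dvd.mul_left (ha μ) _

/-- The iterated derivative of a function along the vector fields `X' k`, in the order given by a
word: the head of the word acts last. -/
noncomputable def wordDeriv (X' : Fin n → (Fin N → ℝ) → (Fin N → ℝ)) (G : (Fin N → ℝ) → ℝ) :
    List (Fin n) → (Fin N → ℝ) → ℝ
  | [] => G
  | k :: J => fun z => fderiv ℝ (wordDeriv X' G J) z (X' k z)

theorem contDiffOn_wordDeriv {V : Set (Fin N → ℝ)} (hV : IsOpen V)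
    {X' : Fin n → (Fin N → ℝ) → (Fin N → ℝ)} (hX : ∀ k, ContDiffOn ℝ ∞ (X' k) V)
    {G : (Fin N → ℝ) → ℝ} (hG : ContDiffOn ℝ ∞ G V) (J : List (Fin n)) :
    ContDiffOn ℝ ∞ (wordDeriv X' G J) V := by
  induction J with
  | nil => exact hG
  | cons k J ih =>
    exact (ih.fderiv_of_isOpen hV (m := ∞) (by simp)).clm_apply (hX k)

/-- Along a curve with controls `a`, known to order `e`, the Taylor series of a function and of its
iterated derivatives agree with the formal flow to order `e + 1`. -/
theorem X_pow_dvd_taylorAt_sub_flow {V : Set (Fin N → ℝ)} (hV : IsOpen V)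
    {X' : Fin n → (Fin N → ℝ) → (Fin N → ℝ)} (hX : ∀ k, ContDiffOn ℝ ∞ (X' k) V)
    {u : ℝ → Fin N → ℝ} (hu : ContDiff ℝ ∞ u) {x : ℝ} (hx : u x ∈ V) {a : Fin n → ℝ⟦X⟧} {e : ℕ}
    (ha : ∀ μ, (X : ℝ⟦X⟧) ^ e ∣
      taylorAt x (fun t => deriv u t μ) - ∑ k, a k * taylorAt x (fun t => X' k (u t) μ))
    {G : (Fin N → ℝ) → ℝ} (hG : ContDiffOn ℝ ∞ G V) (J : List (Fin n)) :
    (X : ℝ⟦X⟧) ^ (e + 1) ∣ taylorAt x (fun t => wordDeriv X' G J (u t)) -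
      flow a (fun J => wordDeriv X' G J (u x)) J := by
  refine X_pow_succ_dvd_sub_of_system (a := a) (b := a)
    (f := fun J => taylorAt x (fun t => wordDeriv X' G J (u t)))
    (g := flow a (fun J => wordDeriv X' G J (u x))) ?_ ?_ ?_ ?_ J
  · intro k; simp
  · intro J
    exact X_pow_dvd_derivative_taylorAt_comp hV hX hu hx ha (contDiffOn_wordDeriv hV hX hG J)
  · intro J
    rw [derivative_flow, sub_self]
    exact dvd_zero _
  · intro J
    rw [coeff_zero_taylorAt, coeff_zero_flow]

end Taylor

/-! ### Local frames and iterated brackets -/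

section Frames

open Filter Topology VectorField

variable {n p N : ℕ}

/-- `IsAdaptedFrame lam V ξ X'`: on the open set `V`, the smooth vector fields `X' k` form a frame
of the common kernel of the forms `lam s`, dual to the constant covectors `ξ k`, which complete
the `lam s` to a coframe. -/
structure IsAdaptedFrame (lam : Fin p → (Fin N → ℝ) → ((Fin N → ℝ) →L[ℝ] ℝ))
    (V : Set (Fin N → ℝ)) (ξ : Fin n → (Fin N → ℝ) →L[ℝ] ℝ)
    (X' : Fin n → (Fin N → ℝ) → (Fin N → ℝ)) : Prop where
  isOpen : IsOpen V
  contDiffOn : ∀ k, ContDiffOn ℝ ∞ (X' k) V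
  dual : ∀ z ∈ V, ∀ j k, ξ j (X' k z) = if j = k then 1 else 0
  lam_eq_zero : ∀ z ∈ V, ∀ k s, lam s z (X' k z) = 0
  separating : ∀ z ∈ V, ∀ v, (∀ k, ξ k v = 0) → (∀ s, lam s z v = 0) → v = 0

/-- A distribution given by a smooth coframe has an adapted frame near each point. -/
theorem exists_isAdaptedFrame (hN : N = n + p) {D : (Fin N → ℝ) → Submodule ℝ (Fin N → ℝ)}
    {lam : Fin p → (Fin N → ℝ) → ((Fin N → ℝ) →L[ℝ] ℝ)} (hD : IsDistribution n D)
    (hlam : IsDefiningCoframe D lam) (y : Fin N → ℝ) :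
    ∃ (V : Set (Fin N → ℝ)) (ξ : Fin n → (Fin N → ℝ) →L[ℝ] ℝ)
      (X' : Fin n → (Fin N → ℝ) → (Fin N → ℝ)), y ∈ V ∧ IsAdaptedFrame lam V ξ X' := by
  obtain ⟨hsm, -, hker⟩ := hlam
  have hrank : Module.finrank ℝ (D y) = Module.finrank ℝ (Fin n → ℝ) := by
    obtain ⟨U, Y, -, hyU, -, hY⟩ := hD y
    rw [(hY y hyU).2, finrank_span_eq_card (hY y hyU).1, Module.finrank_pi]
  let κ : D y ≃ₗ[ℝ] (Fin n → ℝ) := LinearEquiv.ofFinrankEq _ _ hrank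
  -- `g` restricts to an isomorphism on `D y`, so that `Cm z = (g, lam z)` is invertible at `y`
  obtain ⟨g, hg⟩ := LinearMap.exists_extend (κ : D y →ₗ[ℝ] (Fin n → ℝ))
  let gc : (Fin N → ℝ) →L[ℝ] (Fin n → ℝ) := LinearMap.toContinuousLinearMap g
  let Cm : (Fin N → ℝ) → ((Fin N → ℝ) →L[ℝ] (Fin n → ℝ) × (Fin p → ℝ)) := fun z =>
    gc.prod (ContinuousLinearMap.pi fun s => lam s z)
  have hCs : ContDiff ℝ ∞ Cm := by
    have h1 : ContDiff ℝ ∞ (fun z => ContinuousLinearMap.pi fun s => lam s z) := by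
      have : (fun z => ContinuousLinearMap.pi fun s => lam s z)
          = fun z => ∑ s, (ContinuousLinearMap.single ℝ (fun _ : Fin p => ℝ) s).comp (lam s z) := by
        ext z v s
        simp [Pi.single_apply]
      rw [this]
      exact ContDiff.sum fun s _ => contDiff_const.clm_comp (hsm s)
    have h2 : Cm = fun z => (ContinuousLinearMap.inl ℝ (Fin n → ℝ) (Fin p → ℝ)).comp gc +
        (ContinuousLinearMap.inr ℝ (Fin n → ℝ) (Fin p → ℝ)).comp
          (ContinuousLinearMap.pi fun s => lam s z) := by
      funext z
      refine ContinuousLinearMap.ext fun v => Prod.ext ?_ ?_ <;> simp [Cm]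
    rw [h2]
    exact contDiff_const.add (contDiff_const.clm_comp h1)
  let V : Set (Fin N → ℝ) := Cm ⁻¹' Set.range
    ((↑) : ((Fin N → ℝ) ≃L[ℝ] (Fin n → ℝ) × (Fin p → ℝ)) → _)
  have hyV : y ∈ V := by
    have hinj : Function.Injective (Cm y : (Fin N → ℝ) →ₗ[ℝ] (Fin n → ℝ) × (Fin p → ℝ)) := by
      rw [← LinearMap.ker_eq_bot, LinearMap.ker_eq_bot']
      intro v hv
      have hv1 : g v = 0 := congrArg Prod.fst hv
      have hv2 : ∀ s, lam s y v = 0 := fun s => congrFun (congrArg Prod.snd hv) s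
      have hvD : v ∈ D y := (hker y v).mpr hv2
      have : κ ⟨v, hvD⟩ = 0 := (LinearMap.congr_fun hg ⟨v, hvD⟩).symm.trans hv1
      exact congrArg Subtype.val ((LinearEquiv.map_eq_zero_iff κ).mp this)
    have hfr : Module.finrank ℝ (Fin N → ℝ)
        = Module.finrank ℝ ((Fin n → ℝ) × (Fin p → ℝ)) := by simp [hN]
    refine ⟨(LinearEquiv.ofInjectiveOfFinrankEq _ hinj hfr).toContinuousLinearEquiv, ?_⟩
    ext v <;> rfl
  refine ⟨V, fun k => (ContinuousLinearMap.proj k).comp gc,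
    fun k z => (Cm z).inverse (Pi.single k 1, 0), hyV, ?_, ?_, ?_, ?_, ?_⟩
  · exact ContinuousLinearEquiv.isOpen.preimage hCs.continuous
  · intro k z hz
    obtain ⟨e, he⟩ := hz
    have h1 : ContDiffAt ℝ ∞ ContinuousLinearMap.inverse (Cm z) := by
      rw [← he]; exact contDiffAt_map_inverse e
    exact ((h1.comp z hCs.contDiffAt).clm_apply contDiffAt_const).contDiffWithinAt
  · rintro z ⟨e, he⟩ j k
    have h2 : Cm z ((Cm z).inverse (Pi.single k 1, 0)) = (Pi.single k 1, 0) := by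
      rw [← he]; simp
    refine (congrFun (congrArg Prod.fst h2) j).trans ?_
    simp [Pi.single_apply]
  · rintro z ⟨e, he⟩ k s
    have h2 : Cm z ((Cm z).inverse (Pi.single k 1, 0)) = (Pi.single k 1, 0) := by
      rw [← he]; simp
    exact congrFun (congrArg Prod.snd h2) s
  · rintro z ⟨e, he⟩ v h1 h2
    have h3 : Cm z v = 0 := Prod.ext (funext h1) (funext h2)
    rw [← he] at h3
    exact (map_eq_zero_iff e e.injective).mp h3

/-- The iterated right-nested bracket of the vector fields `X' k` along a nonempty word; the value
on the empty word is `0`. -/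
noncomputable def wordField (X' : Fin n → (Fin N → ℝ) → (Fin N → ℝ)) :
    List (Fin n) → (Fin N → ℝ) → (Fin N → ℝ)
  | [] => 0
  | [k] => X' k
  | k :: j :: J => lieBracket ℝ (X' k) (wordField X' (j :: J))

theorem contDiffOn_wordField {V : Set (Fin N → ℝ)} (hV : IsOpen V)
    {X' : Fin n → (Fin N → ℝ) → (Fin N → ℝ)} (hX : ∀ k, ContDiffOn ℝ ∞ (X' k) V) :
    ∀ J : List (Fin n), ContDiffOn ℝ ∞ (wordField X' J) V
  | [] => contDiffOn_const
  | [k] => hX k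
  | k :: j :: J => fun z hz =>
    (((hX k).contDiffAt (hV.mem_nhds hz)).lieBracket_vectorField
      ((contDiffOn_wordField hV hX (j :: J)).contDiffAt (hV.mem_nhds hz))
      (m := ∞) (by simp)).contDiffWithinAt

/-- `FrameCombo X' V i Y`: on `V`, the vector field `Y` is a combination, with smooth coefficients,
of iterated brackets of the `X' k` of length at most `i`. -/
inductive FrameCombo (X' : Fin n → (Fin N → ℝ) → (Fin N → ℝ)) (V : Set (Fin N → ℝ)) (i : ℕ) :
    ((Fin N → ℝ) → (Fin N → ℝ)) → Prop
  | zero : FrameCombo X' V i (fun _ => 0)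
  | word (J : List (Fin n)) (h1 : J ≠ []) (h2 : J.length ≤ i) :
      FrameCombo X' V i (wordField X' J)
  | add {Y Z : (Fin N → ℝ) → (Fin N → ℝ)} (hY : FrameCombo X' V i Y) (hZ : FrameCombo X' V i Z) :
      FrameCombo X' V i (fun z => Y z + Z z)
  | smul {f : (Fin N → ℝ) → ℝ} {Y : (Fin N → ℝ) → (Fin N → ℝ)} (hf : ContDiffOn ℝ ∞ f V)
      (hY : FrameCombo X' V i Y) : FrameCombo X' V i (fun z => f z • Y z)
  | congr {Y Z : (Fin N → ℝ) → (Fin N → ℝ)} (hY : FrameCombo X' V i Y)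
      (h : ∀ z ∈ V, Z z = Y z) : FrameCombo X' V i Z

namespace FrameCombo

variable {X' : Fin n → (Fin N → ℝ) → (Fin N → ℝ)} {V : Set (Fin N → ℝ)}

theorem mono {i j : ℕ} (hij : i ≤ j) {Y : (Fin N → ℝ) → (Fin N → ℝ)}
    (hY : FrameCombo X' V i Y) : FrameCombo X' V j Y := by
  induction hY with
  | zero => exact zero
  | word J h1 h2 => exact word J h1 (h2.trans hij)
  | add _ _ ih1 ih2 => exact add ih1 ih2
  | smul hf _ ih => exact smul hf ih
  | congr _ h ih => exact congr ih h

theorem smooth (hV : IsOpen V) (hX : ∀ k, ContDiffOn ℝ ∞ (X' k) V) {i : ℕ}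
    {Y : (Fin N → ℝ) → (Fin N → ℝ)} (hY : FrameCombo X' V i Y) : ContDiffOn ℝ ∞ Y V := by
  induction hY with
  | zero => exact contDiffOn_const
  | word J h1 h2 => exact contDiffOn_wordField hV hX J
  | add _ _ ih1 ih2 => exact ih1.add ih2
  | smul hf _ ih => exact hf.smul ih
  | congr _ h ih => exact ih.congr h

theorem sum {i : ℕ} {ι : Type*} (s : Finset ι) {Y : ι → (Fin N → ℝ) → (Fin N → ℝ)}
    (hY : ∀ j ∈ s, FrameCombo X' V i (Y j)) : FrameCombo X' V i (fun z => ∑ j ∈ s, Y j z) := by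
  classical
  induction s using Finset.induction_on with
  | empty => simpa using zero
  | insert j s hj ih =>
    simp only [Finset.sum_insert hj]
    exact add (hY j (Finset.mem_insert_self j s))
      (ih fun k hk => hY k (Finset.mem_insert_of_mem hk))

theorem mem_span {i : ℕ} {Y : (Fin N → ℝ) → (Fin N → ℝ)} (hY : FrameCombo X' V i Y)
    {y : Fin N → ℝ} (hy : y ∈ V) :
    Y y ∈ Submodule.span ℝ {v | ∃ J : List (Fin n), J ≠ [] ∧ J.length ≤ i ∧
      wordField X' J y = v} := by
  induction hY with
  | zero => exact Submodule.zero_mem _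
  | word J h1 h2 => exact Submodule.subset_span ⟨J, h1, h2, rfl⟩
  | add _ _ ih1 ih2 => exact Submodule.add_mem _ ih1 ih2
  | smul _ _ ih => exact Submodule.smul_mem _ _ ih
  | congr _ h ih => rw [h y hy]; exact ih

/-- The Leibniz rule for brackets with a field of the frame; right-nested words are lengthened at
the head only, so that no Jacobi identity is needed. -/
theorem bracket_frame (hV : IsOpen V) (hX : ∀ k, ContDiffOn ℝ ∞ (X' k) V) (k : Fin n) {i : ℕ}
    {Y : (Fin N → ℝ) → (Fin N → ℝ)} (hY : FrameCombo X' V i Y) :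
    FrameCombo X' V (i + 1) (lieBracket ℝ (X' k) Y) := by
  induction hY with
  | zero =>
    refine congr zero fun z _ => ?_
    exact congrFun (lieBracket_zero_right (𝕜 := ℝ)) z
  | word J h1 h2 =>
    match J, h1, h2 with
    | j :: J, _, h2 => exact word (k :: j :: J) (by simp) (by simpa using h2)
  | add hY hZ ih1 ih2 =>
    refine congr (add ih1 ih2) fun z hz => ?_
    exact lieBracket_add_right
      (((hY.smooth hV hX).contDiffAt (hV.mem_nhds hz)).differentiableAt (by simp))
      (((hZ.smooth hV hX).contDiffAt (hV.mem_nhds hz)).differentiableAt (by simp))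
  | smul hf hY ih =>
    refine congr (add (smul ((hf.fderiv_of_isOpen hV (m := ∞) (by simp)).clm_apply (hX k))
      (hY.mono (Nat.le_succ i))) (smul hf ih)) fun z hz => ?_
    exact lieBracket_smul_right ((hf.contDiffAt (hV.mem_nhds hz)).differentiableAt (by simp))
      (((hY.smooth hV hX).contDiffAt (hV.mem_nhds hz)).differentiableAt (by simp))
  | congr _ h ih =>
    refine congr ih fun z hz => ?_
    exact EventuallyEq.lieBracket_vectorField_eq (EventuallyEq.refl _ _)
      (eventually_of_mem (hV.mem_nhds hz) h)

theorem bracket (hV : IsOpen V) (hX : ∀ k, ContDiffOn ℝ ∞ (X' k) V) {i : ℕ}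
    {Y Z : (Fin N → ℝ) → (Fin N → ℝ)} (hY : FrameCombo X' V 1 Y) (hZ : FrameCombo X' V i Z) :
    FrameCombo X' V (i + 1) (lieBracket ℝ Y Z) := by
  have hZs := hZ.smooth hV hX
  induction hY with
  | zero =>
    refine congr zero fun z _ => ?_
    exact congrFun (lieBracket_zero_left (𝕜 := ℝ)) z
  | word J h1 h2 =>
    match J, h1, h2 with
    | [j], _, _ => exact hZ.bracket_frame hV hX j
    | j :: k :: J, _, h2 => simp at h2
  | add hY hY' ih1 ih2 =>
    refine congr (add ih1 ih2) fun z hz => ?_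
    exact lieBracket_add_left
      (((hY.smooth hV hX).contDiffAt (hV.mem_nhds hz)).differentiableAt (by simp))
      (((hY'.smooth hV hX).contDiffAt (hV.mem_nhds hz)).differentiableAt (by simp))
  | smul hf hY ih =>
    refine congr (add (smul ((hf.fderiv_of_isOpen hV (m := ∞) (by simp)).clm_apply hZs).neg
      (hY.mono (Nat.le_add_left 1 i))) (smul hf ih)) fun z hz => ?_
    exact lieBracket_smul_left ((hf.contDiffAt (hV.mem_nhds hz)).differentiableAt (by simp))
      (((hY.smooth hV hX).contDiffAt (hV.mem_nhds hz)).differentiableAt (by simp))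
  | congr _ h ih =>
    refine congr ih fun z hz => ?_
    exact EventuallyEq.lieBracket_vectorField_eq (eventually_of_mem (hV.mem_nhds hz) h)
      (EventuallyEq.refl _ _)

end FrameCombo

theorem IsAdaptedFrame.mono {lam : Fin p → (Fin N → ℝ) → ((Fin N → ℝ) →L[ℝ] ℝ)}
    {V W : Set (Fin N → ℝ)} {ξ : Fin n → (Fin N → ℝ) →L[ℝ] ℝ}
    {X' : Fin n → (Fin N → ℝ) → (Fin N → ℝ)} (h : IsAdaptedFrame lam V ξ X') (hW : IsOpen W)
    (hWV : W ⊆ V) : IsAdaptedFrame lam W ξ X' where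
  isOpen := hW
  contDiffOn k := (h.contDiffOn k).mono hWV
  dual z hz := h.dual z (hWV hz)
  lam_eq_zero z hz := h.lam_eq_zero z (hWV hz)
  separating z hz := h.separating z (hWV hz)

/-- Sections of the Lie flag are combinations of iterated brackets of a frame. -/
theorem IsFlagSection.frameCombo {D : (Fin N → ℝ) → Submodule ℝ (Fin N → ℝ)}
    {lam : Fin p → (Fin N → ℝ) → ((Fin N → ℝ) →L[ℝ] ℝ)} (hlam : IsDefiningCoframe D lam)
    {U V : Set (Fin N → ℝ)} {ξ : Fin n → (Fin N → ℝ) →L[ℝ] ℝ}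
    {X' : Fin n → (Fin N → ℝ) → (Fin N → ℝ)} (hV : IsAdaptedFrame lam V ξ X') (hVU : V ⊆ U)
    {i : ℕ} {Y : (Fin N → ℝ) → (Fin N → ℝ)} (hY : IsFlagSection D U i Y) :
    FrameCombo X' V i Y := by
  induction hY with
  | zero => exact FrameCombo.zero
  | base hX hD =>
    rename_i Y
    refine FrameCombo.congr (FrameCombo.sum Finset.univ
      (Y := fun k z => ξ k (Y z) • X' k z) fun k _ => ?_) fun z hz => ?_
    · exact FrameCombo.smul ((ξ k).contDiff.comp_contDiffOn (hX.mono hVU))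
        (FrameCombo.word [k] (by simp) (by simp))
    · rw [← sub_eq_zero]
      refine hV.separating z hz _ (fun j => ?_) fun s => ?_
      · simp [map_sub, map_sum, hV.dual z hz]
      · rw [map_sub, (hlam.2.2 z _).mp (hD z (hVU hz)) s, map_sum]
        simp [hV.lam_eq_zero z hz]
  | mono _ ih => exact ih.mono (Nat.le_succ _)
  | bracket _ _ ih1 ih2 => exact FrameCombo.bracket hV.isOpen hV.contDiffOn ih1 ih2
  | add _ _ ih1 ih2 => exact FrameCombo.add ih1 ih2
  | smul hf _ ih => exact FrameCombo.smul (hf.mono hVU) ih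

/-- The values of the Lie flag are spanned by the iterated brackets of a frame. -/
theorem flagAt_le_span_wordField {D : (Fin N → ℝ) → Submodule ℝ (Fin N → ℝ)}
    {lam : Fin p → (Fin N → ℝ) → ((Fin N → ℝ) →L[ℝ] ℝ)} (hlam : IsDefiningCoframe D lam)
    {V : Set (Fin N → ℝ)} {ξ : Fin n → (Fin N → ℝ) →L[ℝ] ℝ}
    {X' : Fin n → (Fin N → ℝ) → (Fin N → ℝ)} (hV : IsAdaptedFrame lam V ξ X')
    {y : Fin N → ℝ} (hy : y ∈ V) (i : ℕ) :
    flagAt D i y ≤ Submodule.span ℝ {v | ∃ J : List (Fin n), J ≠ [] ∧ J.length ≤ i ∧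
      wordField X' J y = v} := by
  refine Submodule.span_le.mpr ?_
  rintro v ⟨U, Y, hU, hyU, hY, rfl⟩
  exact (IsFlagSection.frameCombo hlam (hV.mono (hV.isOpen.inter hU) Set.inter_subset_left)
    Set.inter_subset_right hY).mem_span ⟨hy, hyU⟩

end Frames

/-! ### Horizontal curves, their controls and the adjoint equation -/

section Curves

open PowerSeries Filter Topology VectorField

variable {n p N : ℕ} {lam : Fin p → (Fin N → ℝ) → ((Fin N → ℝ) →L[ℝ] ℝ)}
  {V : Set (Fin N → ℝ)} {ξ : Fin n → (Fin N → ℝ) →L[ℝ] ℝ}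
  {X' : Fin n → (Fin N → ℝ) → (Fin N → ℝ)} {u : ℝ → Fin N → ℝ} {x : ℝ}

theorem contDiffAt_horizOp (hsm : ∀ s, ContDiff ℝ ∞ (lam s)) (hu : ContDiff ℝ ∞ u) :
    ContDiffAt ℝ ∞ (horizOp lam u) x := by
  refine contDiffAt_pi.mpr fun s => ?_
  exact ((hsm s).comp hu).contDiffAt.clm_apply hu.contDiffAt.deriv_of_infty

/-- As the forms `lam s` vanish on the frame, they take the same value on the velocity and on its
difference with any combination of the frame. -/
theorem taylorAt_horizOp_eq (hF : IsAdaptedFrame lam V ξ X') (hsm : ∀ s, ContDiff ℝ ∞ (lam s))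
    (hu : ContDiff ℝ ∞ u) (hx : u x ∈ V) (a : Fin n → ℝ⟦X⟧) (s : Fin p) :
    taylorAt x (fun t => horizOp lam u t s) =
      ∑ μ, taylorAt x (fun t => lam s (u t) (Pi.single μ 1)) *
        (taylorAt x (fun t => deriv u t μ) - ∑ k, a k * taylorAt x (fun t => X' k (u t) μ)) := by
  have hA : ContDiffAt ℝ ∞ (fun t => lam s (u t)) x := ((hsm s).comp hu).contDiffAt
  have hXx : ∀ k, ContDiffAt ℝ ∞ (fun t => X' k (u t)) x := fun k =>
    ((hF.contDiffOn k).contDiffAt (hF.isOpen.mem_nhds hx)).comp x hu.contDiffAt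
  have hev : ∀ᶠ t in 𝓝 x, u t ∈ V := hu.continuous.continuousAt (hF.isOpen.mem_nhds hx)
  have h0 : ∀ k, ∑ μ, taylorAt x (fun t => lam s (u t) (Pi.single μ 1)) *
      taylorAt x (fun t => X' k (u t) μ) = 0 := by
    intro k
    rw [← taylorAt_clm_apply hA (hXx k)]
    have : (fun t => lam s (u t) (X' k (u t))) =ᶠ[𝓝 x] fun _ => (0 : ℝ) := by
      filter_upwards [hev] with t ht using hF.lam_eq_zero _ ht k s
    rw [taylorAt_congr this, taylorAt_const, map_zero]
  have h1 : ∑ μ, taylorAt x (fun t => lam s (u t) (Pi.single μ 1)) *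
      ∑ k, a k * taylorAt x (fun t => X' k (u t) μ) = 0 := by
    simp only [Finset.mul_sum]
    rw [Finset.sum_comm]
    refine Finset.sum_eq_zero fun k _ => ?_
    rw [← mul_zero (a k), ← h0 k, Finset.mul_sum]
    exact Finset.sum_congr rfl fun μ _ => by ring
  simp only [mul_sub, Finset.sum_sub_distrib]
  rw [h1, sub_zero]
  exact taylorAt_clm_apply hA hu.contDiffAt.deriv_of_infty

/-- The velocity of a curve which is horizontal to order `e` is, to order `e`, the combination of
the frame given by its controls `ξ k (u')`. -/
theorem X_pow_dvd_velocity_sub (hF : IsAdaptedFrame lam V ξ X')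
    (hsm : ∀ s, ContDiff ℝ ∞ (lam s)) (hu : ContDiff ℝ ∞ u) (hx : u x ∈ V) {e : ℕ}
    (hh : ∀ i < e, iteratedDeriv i (horizOp lam u) x = 0) (μ : Fin N) :
    (X : ℝ⟦X⟧) ^ e ∣ taylorAt x (fun t => deriv u t μ) -
      ∑ k, taylorAt x (fun t => ξ k (deriv u t)) * taylorAt x (fun t => X' k (u t) μ) := by
  set err : Fin N → ℝ⟦X⟧ := fun μ => taylorAt x (fun t => deriv u t μ) -
      ∑ k, taylorAt x (fun t => ξ k (deriv u t)) * taylorAt x (fun t => X' k (u t) μ) with herr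
  have hu' := (hu.contDiffAt (x := x)).deriv_of_infty
  have hXx : ∀ k, ContDiffAt ℝ ∞ (fun t => X' k (u t)) x := fun k =>
    ((hF.contDiffOn k).contDiffAt (hF.isOpen.mem_nhds hx)).comp x hu.contDiffAt
  have hev : ∀ᶠ t in 𝓝 x, u t ∈ V := hu.continuous.continuousAt (hF.isOpen.mem_nhds hx)
  -- the error is annihilated by the `ξ j` exactly, and by the `lam s` to order `e`
  have hξ : ∀ j, ∑ μ, C (ξ j (Pi.single μ 1)) * err μ = 0 := by
    intro j
    have h1 : ∀ (v : ℝ → Fin N → ℝ), ContDiffAt ℝ ∞ v x →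
        ∑ μ, C (ξ j (Pi.single μ 1)) * taylorAt x (fun t => v t μ)
          = taylorAt x (fun t => ξ j (v t)) := by
      intro v hv
      rw [taylorAt_clm_apply (A := fun _ => ξ j) contDiffAt_const hv]
      simp only [taylorAt_const]
    have h2 : ∀ k, taylorAt x (fun t => ξ j (X' k (u t))) = if j = k then 1 else 0 := by
      intro k
      have : (fun t => ξ j (X' k (u t))) =ᶠ[𝓝 x] fun _ => if j = k then 1 else 0 := by
        filter_upwards [hev] with t ht using hF.dual _ ht j k
      rw [taylorAt_congr this, taylorAt_const]
      split_ifs <;> simp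
    simp only [herr, mul_sub, Finset.sum_sub_distrib]
    rw [h1 _ hu', sub_eq_zero]
    simp only [Finset.mul_sum]
    rw [Finset.sum_comm]
    have h3 : ∀ k, ∑ μ, C (ξ j (Pi.single μ 1)) *
        (taylorAt x (fun t => ξ k (deriv u t)) * taylorAt x (fun t => X' k (u t) μ))
        = taylorAt x (fun t => ξ k (deriv u t)) * if j = k then 1 else 0 := by
      intro k
      rw [← h2 k, ← h1 _ (hXx k), Finset.mul_sum]
      exact Finset.sum_congr rfl fun μ _ => by ring
    simp only [h3]
    simp
  have hl : ∀ s, (X : ℝ⟦X⟧) ^ e ∣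
      ∑ μ, taylorAt x (fun t => lam s (u t) (Pi.single μ 1)) * err μ := by
    intro s
    rw [← taylorAt_horizOp_eq hF hsm hu hx, X_pow_dvd_taylorAt_iff]
    intro i hi
    rw [← iteratedDeriv_apply_of_contDiffAt (contDiffAt_horizOp hsm hu), hh i hi]
    rfl
  have key : ∀ i ≤ e, ∀ μ, (X : ℝ⟦X⟧) ^ i ∣ err μ := by
    intro i
    induction i with
    | zero => intro _ μ; simp
    | succ i ih =>
      intro hi
      have ih := ih (by omega)
      have hw : (fun μ => coeff i (err μ)) = 0 := by
        refine hF.separating _ hx _ (fun j => ?_) fun s => ?_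
        · rw [ContinuousLinearMap.apply_eq_sum_single]
          have := congrArg (coeff i) (hξ j)
          simpa [map_sum, coeff_C_mul] using this
        · rw [ContinuousLinearMap.apply_eq_sum_single]
          have := X_pow_dvd_iff.mp (hl s) i (by omega)
          rw [map_sum] at this
          rw [← this]
          refine Finset.sum_congr rfl fun μ _ => ?_
          have h4 := coeff_add_mul_of_X_pow_dvd (p := 0) (q := i)
            (f := taylorAt x (fun t => lam s (u t) (Pi.single μ 1))) (by simp) (ih μ)
          rw [zero_add] at h4
          rw [h4, coeff_zero_taylorAt]
      intro μ
      rw [X_pow_dvd_iff]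
      intro j hj
      rcases Nat.lt_succ_iff_lt_or_eq.mp hj with h | rfl
      · exact X_pow_dvd_iff.mp (ih μ) j h
      · exact congrFun hw μ
  exact key e le_rfl μ

/-- A curve whose velocity is in the span of the frame to order `e` is horizontal to order `e`. -/
theorem iteratedDeriv_horizOp_eq_zero (hF : IsAdaptedFrame lam V ξ X')
    (hsm : ∀ s, ContDiff ℝ ∞ (lam s)) (hu : ContDiff ℝ ∞ u) (hx : u x ∈ V) {a : Fin n → ℝ⟦X⟧}
    {e : ℕ} (ha : ∀ μ, (X : ℝ⟦X⟧) ^ e ∣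
      taylorAt x (fun t => deriv u t μ) - ∑ k, a k * taylorAt x (fun t => X' k (u t) μ))
    {i : ℕ} (hi : i < e) : iteratedDeriv i (horizOp lam u) x = 0 := by
  ext s
  rw [iteratedDeriv_apply_of_contDiffAt (contDiffAt_horizOp hsm hu)]
  refine X_pow_dvd_taylorAt_iff.mp ?_ i hi
  rw [taylorAt_horizOp_eq hF hsm hu hx a s]
  exact Finset.dvd_sum fun μ _ => Dvd.dvd.mul_left (ha μ) _

theorem ContDiffAt.clm_flip_apply {f : ℝ → (Fin N → ℝ) →L[ℝ] (Fin N → ℝ) →L[ℝ] ℝ}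
    {v : ℝ → Fin N → ℝ} (hf : ContDiffAt ℝ ∞ f x) (hv : ContDiffAt ℝ ∞ v x) :
    ContDiffAt ℝ ∞ (fun t => (f t).flip (v t)) x := by
  have : (fun t => (f t).flip (v t)) = fun t => ∑ μ, (f t (Pi.single μ 1) (v t)) •
      ContinuousLinearMap.proj (R := ℝ) (φ := fun _ : Fin N => ℝ) μ := by
    ext t w
    rw [ContinuousLinearMap.apply_eq_sum_single]
    simp
  rw [this]
  exact ContDiffAt.sum fun μ _ =>
    ((hf.clm_apply contDiffAt_const).clm_apply hv).smul contDiffAt_const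

/-- Cartan's formula `Z (η Y) = dη(Z, Y) + η [Z, Y]`, when `η Z = 0`. -/
theorem fderiv_clm_apply_eq_extD_add {η : (Fin N → ℝ) → ((Fin N → ℝ) →L[ℝ] ℝ)}
    {Y Z : (Fin N → ℝ) → (Fin N → ℝ)} {z : Fin N → ℝ} (hη : DifferentiableAt ℝ η z)
    (hY : DifferentiableAt ℝ Y z) (hZ : DifferentiableAt ℝ Z z)
    (h0 : (fun w => η w (Z w)) =ᶠ[𝓝 z] fun _ => 0) :
    fderiv ℝ (fun w => η w (Y w)) z (Z z) =
      extD η z (Z z) (Y z) + η z (lieBracket ℝ Z Y z) := by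
  have h1 : fderiv ℝ (fun w => η w (Z w)) z (Y z) = 0 := by
    rw [h0.fderiv_eq]; simp
  rw [fderiv_clm_apply hη hZ] at h1
  rw [fderiv_clm_apply hη hY, extD, lieBracket, map_sub]
  simp only [_root_.add_apply, ContinuousLinearMap.comp_apply,
    ContinuousLinearMap.flip_apply] at h1 ⊢
  linarith

/-- **The adjoint equation**: if the covector `∑ₛ Ψₛ λˢ` solves, to order `e`, the adjoint of the
linearised horizontality equation along `u`, then the derivative of its pairing with a vector field
`Y` is its pairing with the bracket of the velocity and `Y`. -/
theorem X_pow_dvd_derivative_pairing (hF : IsAdaptedFrame lam V ξ X')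
    (hsm : ∀ s, ContDiff ℝ ∞ (lam s)) (hu : ContDiff ℝ ∞ u) (hx : u x ∈ V) {a : Fin n → ℝ⟦X⟧}
    {e : ℕ} (ha : ∀ μ, (X : ℝ⟦X⟧) ^ e ∣
      taylorAt x (fun t => deriv u t μ) - ∑ k, a k * taylorAt x (fun t => X' k (u t) μ))
    {Ψ : Fin p → ℝ⟦X⟧}
    (hΨ : ∀ μ, (X : ℝ⟦X⟧) ^ e ∣ ∑ s, (Ψ s * taylorAt x (entryR lam u s μ)
      + d⁄dX ℝ (Ψ s) * taylorAt x (entryLambda lam u s μ)))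
    {Y : (Fin N → ℝ) → (Fin N → ℝ)} (hY : ContDiffOn ℝ ∞ Y V) :
    (X : ℝ⟦X⟧) ^ e ∣ d⁄dX ℝ (∑ s, Ψ s * taylorAt x (fun t => lam s (u t) (Y (u t)))) -
      ∑ k, a k * ∑ s, Ψ s * taylorAt x
        (fun t => lam s (u t) (lieBracket ℝ (X' k) Y (u t))) := by
  have hu' := (hu.contDiffAt (x := x)).deriv_of_infty
  have hVx := hF.isOpen.mem_nhds hx
  have hXx : ∀ k, ContDiffAt ℝ ∞ (fun t => X' k (u t)) x := fun k =>
    ((hF.contDiffOn k).contDiffAt hVx).comp x hu.contDiffAt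
  have hYx : ContDiffAt ℝ ∞ (fun t => Y (u t)) x := (hY.contDiffAt hVx).comp x hu.contDiffAt
  have hev : ∀ᶠ t in 𝓝 x, u t ∈ V := hu.continuous.continuousAt hVx
  have hlx : ∀ s, ContDiffAt ℝ ∞ (fun t => lam s (u t)) x := fun s =>
    ((hsm s).comp hu).contDiffAt
  have hdl : ∀ s, ContDiffAt ℝ ∞ (fun t => fderiv ℝ (lam s) (u t)) x := fun s =>
    (((hsm s).fderiv_right (m := ∞) (by simp)).comp hu).contDiffAt
  -- the `1`-forms `dλ(·, Y)` and `dλ(u', ·)` along the curve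
  let B : Fin p → ℝ → (Fin N → ℝ) →L[ℝ] ℝ := fun s t =>
    (fderiv ℝ (lam s) (u t)).flip (Y (u t)) - fderiv ℝ (lam s) (u t) (Y (u t))
  let R : Fin p → ℝ → (Fin N → ℝ) →L[ℝ] ℝ := fun s t =>
    fderiv ℝ (lam s) (u t) (deriv u t) - (fderiv ℝ (lam s) (u t)).flip (deriv u t)
  have hB : ∀ s, ContDiffAt ℝ ∞ (B s) x := fun s =>
    ((hdl s).clm_flip_apply hYx).sub ((hdl s).clm_apply hYx)
  have hR : ∀ s, ContDiffAt ℝ ∞ (R s) x := fun s =>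
    ((hdl s).clm_apply hu').sub ((hdl s).clm_flip_apply hu')
  have hBR : ∀ s, ∑ μ, taylorAt x (fun t => B s t (Pi.single μ 1)) *
        taylorAt x (fun t => deriv u t μ)
      = ∑ μ, taylorAt x (entryR lam u s μ) * taylorAt x (fun t => Y (u t) μ) := by
    intro s
    rw [← taylorAt_clm_apply (hB s) hu']
    have : (fun t => B s t (deriv u t)) = fun t => R s t (Y (u t)) := by
      ext t; simp [B, R]
    rw [this, taylorAt_clm_apply (hR s) hYx]
    rfl
  have hX2 : ∀ s k, taylorAt x (fun t => fderiv ℝ (fun w => lam s w (Y w)) (u t) (X' k (u t)))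
      = ∑ μ, taylorAt x (fun t => B s t (Pi.single μ 1)) * taylorAt x (fun t => X' k (u t) μ)
        + taylorAt x (fun t => lam s (u t) (lieBracket ℝ (X' k) Y (u t))) := by
    intro s k
    have hbr : ContDiffAt ℝ ∞ (fun t => lieBracket ℝ (X' k) Y (u t)) x :=
      ContDiffAt.comp x (((hF.contDiffOn k).contDiffAt hVx).lieBracket_vectorField
        (hY.contDiffAt hVx) (m := ∞) (by simp)) hu.contDiffAt
    rw [← taylorAt_clm_apply (hB s) (hXx k),
      ← taylorAt_add ((hB s).clm_apply (hXx k)) ((hlx s).clm_apply hbr)]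
    apply taylorAt_congr
    filter_upwards [hev] with t ht
    have hVt := hF.isOpen.mem_nhds ht
    refine (fderiv_clm_apply_eq_extD_add ((hsm s).contDiffAt.differentiableAt (by simp))
      ((hY.contDiffAt hVt).differentiableAt (by simp))
      (((hF.contDiffOn k).contDiffAt hVt).differentiableAt (by simp)) ?_).trans ?_
    · filter_upwards [hVt] with w hw using hF.lam_eq_zero w hw k s
    · simp [B, extD]
  have hchain : ∀ s, (X : ℝ⟦X⟧) ^ e ∣
      d⁄dX ℝ (taylorAt x (fun t => lam s (u t) (Y (u t)))) -
      (∑ μ, taylorAt x (entryR lam u s μ) * taylorAt x (fun t => Y (u t) μ) +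
        ∑ k, a k * taylorAt x (fun t => lam s (u t) (lieBracket ℝ (X' k) Y (u t)))) := by
    intro s
    have h1 := X_pow_dvd_derivative_taylorAt_comp hF.isOpen hF.contDiffOn hu hx ha
      (G := fun w => lam s w (Y w)) ((hsm s).contDiffOn.clm_apply hY)
    have h2 : (X : ℝ⟦X⟧) ^ e ∣ ∑ μ, taylorAt x (fun t => B s t (Pi.single μ 1)) *
        (taylorAt x (fun t => deriv u t μ) - ∑ k, a k * taylorAt x (fun t => X' k (u t) μ)) :=
      Finset.dvd_sum fun μ _ => Dvd.dvd.mul_left (ha μ) _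
    simp only [mul_sub, Finset.sum_sub_distrib] at h2
    rw [hBR s] at h2
    have h3 : ∑ μ, taylorAt x (fun t => B s t (Pi.single μ 1)) *
          ∑ k, a k * taylorAt x (fun t => X' k (u t) μ)
        = ∑ k, a k * ∑ μ, taylorAt x (fun t => B s t (Pi.single μ 1)) *
          taylorAt x (fun t => X' k (u t) μ) := by
      simp only [Finset.mul_sum]
      rw [Finset.sum_comm]
      exact Finset.sum_congr rfl fun _ _ => Finset.sum_congr rfl fun _ _ => by ring
    rw [h3] at h2
    simp only [hX2, mul_add, Finset.sum_add_distrib] at h1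
    have h4 := dvd_sub h1 h2
    convert h4 using 1
    ring
  have hΨY : (X : ℝ⟦X⟧) ^ e ∣ ∑ μ, (∑ s, (Ψ s * taylorAt x (entryR lam u s μ)
      + d⁄dX ℝ (Ψ s) * taylorAt x (entryLambda lam u s μ))) * taylorAt x (fun t => Y (u t) μ) :=
    Finset.dvd_sum fun μ _ => Dvd.dvd.mul_right (hΨ μ) _
  have hsum : (X : ℝ⟦X⟧) ^ e ∣ ∑ s, Ψ s * (d⁄dX ℝ (taylorAt x (fun t => lam s (u t) (Y (u t)))) -
      (∑ μ, taylorAt x (entryR lam u s μ) * taylorAt x (fun t => Y (u t) μ) +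
        ∑ k, a k * taylorAt x (fun t => lam s (u t) (lieBracket ℝ (X' k) Y (u t))))) :=
    Finset.dvd_sum fun s _ => Dvd.dvd.mul_left (hchain s) _
  have hL : ∀ s, taylorAt x (fun t => lam s (u t) (Y (u t)))
      = ∑ μ, taylorAt x (entryLambda lam u s μ) * taylorAt x (fun t => Y (u t) μ) := fun s =>
    taylorAt_clm_apply (hlx s) hYx
  have e1 : ∑ μ, (∑ s, (Ψ s * taylorAt x (entryR lam u s μ)
      + d⁄dX ℝ (Ψ s) * taylorAt x (entryLambda lam u s μ))) * taylorAt x (fun t => Y (u t) μ)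
      = ∑ s, Ψ s * ∑ μ, taylorAt x (entryR lam u s μ) * taylorAt x (fun t => Y (u t) μ)
        + ∑ s, d⁄dX ℝ (Ψ s) * taylorAt x (fun t => lam s (u t) (Y (u t))) := by
    simp only [hL, Finset.mul_sum, Finset.sum_mul, add_mul, Finset.sum_add_distrib]
    congr 1
    · rw [Finset.sum_comm]
      exact Finset.sum_congr rfl fun _ _ => Finset.sum_congr rfl fun _ _ => by ring
    · rw [Finset.sum_comm]
      exact Finset.sum_congr rfl fun _ _ => Finset.sum_congr rfl fun _ _ => by ring
  have e2 : ∑ k, a k * ∑ s, Ψ s * taylorAt x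
        (fun t => lam s (u t) (lieBracket ℝ (X' k) Y (u t)))
      = ∑ s, Ψ s * ∑ k, a k * taylorAt x
        (fun t => lam s (u t) (lieBracket ℝ (X' k) Y (u t))) := by
    simp only [Finset.mul_sum]
    rw [Finset.sum_comm]
    exact Finset.sum_congr rfl fun _ _ => Finset.sum_congr rfl fun _ _ => by ring
  rw [e1] at hΨY
  have h5 := dvd_add hsum hΨY
  convert h5 using 1
  rw [e2, map_sum]
  simp only [Derivation.leibniz, smul_eq_mul, mul_sub, mul_add, Finset.sum_add_distrib,
    Finset.sum_sub_distrib, mul_comm (taylorAt x _) (d⁄dX ℝ _)]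
  ring

/-- A solution of the adjoint equation to order `e` gives a formal flow, with initial values the
pairings of a covector with the iterated brackets of the frame, which vanishes to order `e + 1` on
words of length one. -/
theorem X_pow_dvd_flow_singleton (hF : IsAdaptedFrame lam V ξ X')
    (hsm : ∀ s, ContDiff ℝ ∞ (lam s)) (hu : ContDiff ℝ ∞ u) (hx : u x ∈ V) {a : Fin n → ℝ⟦X⟧}
    {e : ℕ} (ha : ∀ μ, (X : ℝ⟦X⟧) ^ e ∣
      taylorAt x (fun t => deriv u t μ) - ∑ k, a k * taylorAt x (fun t => X' k (u t) μ))
    {Ψ : Fin p → ℝ⟦X⟧}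
    (hΨ : ∀ μ, (X : ℝ⟦X⟧) ^ e ∣ ∑ s, (Ψ s * taylorAt x (entryR lam u s μ)
      + d⁄dX ℝ (Ψ s) * taylorAt x (entryLambda lam u s μ))) (k : Fin n) :
    (X : ℝ⟦X⟧) ^ (e + 1) ∣
      flow a (fun J => ∑ s, coeff 0 (Ψ s) * lam s (u x) (wordField X' J (u x))) [k] := by
  let H : List (Fin n) → ℝ⟦X⟧ := fun J =>
    ∑ s, Ψ s * taylorAt x (fun t => lam s (u t) (wordField X' J (u t)))
  have hev : ∀ᶠ t in 𝓝 x, u t ∈ V :=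
    hu.continuous.continuousAt (hF.isOpen.mem_nhds hx)
  have hH1 : ∀ k, H [k] = 0 := by
    intro k
    refine Finset.sum_eq_zero fun s _ => ?_
    have : (fun t => lam s (u t) (wordField X' [k] (u t))) =ᶠ[𝓝 x] fun _ => (0 : ℝ) := by
      filter_upwards [hev] with t ht using hF.lam_eq_zero _ ht k s
    rw [taylorAt_congr this, taylorAt_const, map_zero, mul_zero]
  have h := X_pow_succ_dvd_sub_of_system (e := e) (a := a) (b := a)
    (f := flow a (fun J => ∑ s, coeff 0 (Ψ s) * lam s (u x) (wordField X' J (u x)))) (g := H)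
    ?_ ?_ ?_ ?_ [k]
  · rwa [hH1, sub_zero] at h
  · intro k; simp
  · intro J
    rw [derivative_flow, sub_self]
    exact dvd_zero _
  · intro J
    match J with
    | [] =>
      have h0 : H [] = 0 := by
        refine Finset.sum_eq_zero fun s _ => ?_
        simp [wordField, taylorAt_const]
      simp [h0, hH1]
    | j :: J =>
      exact X_pow_dvd_derivative_pairing hF hsm hu hx ha hΨ
        (contDiffOn_wordField hF.isOpen hF.contDiffOn (j :: J))
  · intro J
    rw [coeff_zero_flow, map_sum]
    refine Finset.sum_congr rfl fun s _ => ?_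
    rw [coeff_zero_eq_constantCoeff_apply, coeff_zero_eq_constantCoeff_apply, map_mul,
      ← coeff_zero_eq_constantCoeff_apply (taylorAt _ _), coeff_zero_taylorAt]

theorem factorial_mul_coeff_mul_taylorAt (w : ℕ → ℝ) (f : ℝ → ℝ) (k : ℕ) :
    (k.factorial : ℝ) * coeff k (PowerSeries.mk (fun i => w i / i.factorial) * taylorAt x f)
      = ∑ i ∈ Finset.range (k + 1), w i * ((k.choose i : ℝ) * iteratedDeriv (k - i) f x) := by
  rw [coeff_mul, Finset.Nat.sum_antidiagonal_eq_sum_range_succ_mk, Finset.mul_sum]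
  refine Finset.sum_congr rfl fun i hi => ?_
  have hk : i ≤ k := by simpa [Nat.lt_succ_iff] using hi
  rw [coeff_taylorAt, coeff_mk, Nat.cast_choose ℝ hk]
  have h1 : (i.factorial : ℝ) ≠ 0 := by exact_mod_cast i.factorial_ne_zero
  have h2 : ((k - i).factorial : ℝ) ≠ 0 := by exact_mod_cast (k - i).factorial_ne_zero
  have h3 : (k.factorial : ℝ) ≠ 0 := by exact_mod_cast k.factorial_ne_zero
  field_simp

theorem sum_range_choose_extend (w g : ℕ → ℝ) {k m : ℕ} (hkm : k < m) :
    ∑ i ∈ Finset.range (k + 1), w i * ((k.choose i : ℝ) * g i)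
      = ∑ i ∈ Finset.range m, w i * ((k.choose i : ℝ) * g i) := by
  refine Finset.sum_subset (Finset.range_mono hkm) fun i _ hi => ?_
  rw [Finset.mem_range, not_lt] at hi
  rw [Nat.choose_eq_zero_of_lt hi]
  simp

/-- The rows of the regularity matrix, combined with the coefficients `w`, give the Taylor
coefficients of the adjoint equation for the covector with derivatives `w`. -/
theorem sum_mul_blockEntry (w : ℕ → ℝ) (q k : ℕ) (hk : k ≤ q) (s : Fin p) (μ : Fin N) :
    ∑ i ∈ Finset.range (q + 2), w i * blockEntry lam u x k s μ i
      = k.factorial * coeff k (PowerSeries.mk (fun i => w i / i.factorial) *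
          taylorAt x (entryR lam u s μ) + d⁄dX ℝ (PowerSeries.mk (fun i => w i / i.factorial)) *
          taylorAt x (entryLambda lam u s μ)) := by
  have hd : d⁄dX ℝ (PowerSeries.mk (fun i => w i / i.factorial))
      = PowerSeries.mk (fun i => w (i + 1) / i.factorial) := by
    ext i
    rw [coeff_derivative, coeff_mk, coeff_mk, Nat.factorial_succ]
    have h1 : (i.factorial : ℝ) ≠ 0 := by exact_mod_cast i.factorial_ne_zero
    have h2 : (i : ℝ) + 1 ≠ 0 := by positivity
    push_cast
    field_simp
  rw [map_add, mul_add, hd, factorial_mul_coeff_mul_taylorAt w,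
    factorial_mul_coeff_mul_taylorAt (fun i => w (i + 1)),
    sum_range_choose_extend w (fun i => iteratedDeriv (k - i) (entryR lam u s μ) x)
      (show k < q + 2 by omega),
    sum_range_choose_extend (fun i => w (i + 1))
      (fun i => iteratedDeriv (k - i) (entryLambda lam u s μ) x) (show k < q + 1 by omega),
    Finset.sum_range_succ' _ (q + 1), Finset.sum_range_succ' _ (q + 1)]
  simp only [blockEntry, mul_add, Finset.sum_add_distrib, Nat.choose_zero_right, Nat.cast_one,
    one_mul, Nat.sub_zero]
  ring

/-- If the regularity matrix does not have full row rank, then the adjoint equation has a solution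
of order `q + 1` which is nonzero at the base point. -/
theorem exists_adjoint_solution {q : ℕ} (hli : LinearIndependent ℝ (fun s => lam s (u x)))
    (hdep : ¬ LinearIndependent ℝ (fun a => regMatrix lam q u x a)) :
    ∃ Ψ : Fin p → ℝ⟦X⟧, (∃ s, coeff 0 (Ψ s) ≠ 0) ∧
      ∀ μ, (X : ℝ⟦X⟧) ^ (q + 1) ∣ ∑ s, (Ψ s * taylorAt x (entryR lam u s μ)
        + d⁄dX ℝ (Ψ s) * taylorAt x (entryLambda lam u s μ)) := by
  rw [Fintype.not_linearIndependent_iff] at hdep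
  obtain ⟨g, hg, ⟨i₀, s₀⟩, hg0⟩ := hdep
  let w : ℕ → Fin p → ℝ := fun i s => if h : i < q + 2 then g (⟨i, h⟩, s) else 0
  let Ψ : Fin p → ℝ⟦X⟧ := fun s => PowerSeries.mk fun i => w i s / i.factorial
  have hΨ : ∀ μ, (X : ℝ⟦X⟧) ^ (q + 1) ∣ ∑ s, (Ψ s * taylorAt x (entryR lam u s μ)
        + d⁄dX ℝ (Ψ s) * taylorAt x (entryLambda lam u s μ)) := by
    intro μ
    rw [X_pow_dvd_iff]
    intro k hk
    have h1 := congrFun hg (⟨k, hk⟩, μ)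
    rw [Finset.sum_apply, Fintype.sum_prod_type, Finset.sum_comm] at h1
    have h2 : ∀ s, ∑ i : Fin (q + 2), (g (i, s) • fun b => regMatrix lam q u x (i, s) b)
          (⟨k, hk⟩, μ)
        = k.factorial * coeff k (Ψ s * taylorAt x (entryR lam u s μ)
          + d⁄dX ℝ (Ψ s) * taylorAt x (entryLambda lam u s μ)) := by
      intro s
      rw [← sum_mul_blockEntry (fun i => w i s) q k (by omega), Finset.sum_range]
      refine Finset.sum_congr rfl fun i _ => ?_
      simp [w, regMatrix]
    have h3 : (k.factorial : ℝ) * coeff k (∑ s, (Ψ s * taylorAt x (entryR lam u s μ)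
        + d⁄dX ℝ (Ψ s) * taylorAt x (entryLambda lam u s μ))) = 0 := by
      rw [map_sum, Finset.mul_sum]
      simp only [← h2]
      exact h1
    exact (mul_eq_zero.mp h3).resolve_left (by exact_mod_cast k.factorial_ne_zero)
  refine ⟨Ψ, ?_, hΨ⟩
  -- as the `lam s` are independent, the equation determines `Ψ'` from `Ψ`: if the constant terms
  -- of `Ψ` vanished, then so would all entries of `g`
  by_contra hcon
  push Not at hcon
  have key : ∀ i ≤ q + 1, ∀ s, (X : ℝ⟦X⟧) ^ (i + 1) ∣ Ψ s := by
    intro i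
    induction i with
    | zero =>
      intro _ s
      rw [X_pow_dvd_iff]
      intro j hj
      obtain rfl : j = 0 := by omega
      exact hcon s
    | succ i ih =>
      intro hi
      have ih := ih (by omega)
      have hc : ∀ s, coeff (i + 1) (Ψ s) = 0 := by
        refine Fintype.linearIndependent_iff.mp hli _ ?_
        ext v
        rw [ContinuousLinearMap.apply_eq_sum_single]
        refine Finset.sum_eq_zero fun μ _ => ?_
        have h1 := X_pow_dvd_iff.mp (hΨ μ) i (by omega)
        rw [map_sum] at h1
        have h2 : ∀ s, coeff i (Ψ s * taylorAt x (entryR lam u s μ)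
            + d⁄dX ℝ (Ψ s) * taylorAt x (entryLambda lam u s μ))
            = ((i : ℝ) + 1) * (coeff (i + 1) (Ψ s) * lam s (u x) (Pi.single μ 1)) := by
          intro s
          have hd : (X : ℝ⟦X⟧) ^ i ∣ d⁄dX ℝ (Ψ s) := by
            rw [X_pow_dvd_iff]
            intro j hj
            rw [coeff_derivative, X_pow_dvd_iff.mp (ih s) (j + 1) (by omega), zero_mul]
          have h3 := coeff_add_mul_of_X_pow_dvd (p := i) (q := 0) hd
            (g := taylorAt x (entryLambda lam u s μ)) (by simp)
          rw [add_zero, coeff_zero_taylorAt, coeff_derivative] at h3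
          rw [map_add, h3, X_pow_dvd_iff.mp (Dvd.dvd.mul_right (ih s) _) i (by omega), zero_add,
            entryLambda]
          ring
        simp only [h2, ← Finset.mul_sum] at h1
        have h4 := (mul_eq_zero.mp h1).resolve_left (by positivity)
        have h5 : (∑ s, coeff (i + 1) (Ψ s) • lam s (u x)) (Pi.single μ 1) = 0 := by
          simpa using h4
        rw [h5, zero_mul]
      intro s
      rw [X_pow_dvd_iff]
      intro j hj
      rcases Nat.lt_succ_iff_lt_or_eq.mp hj with h | rfl
      · exact X_pow_dvd_iff.mp (ih s) j h
      · exact hc s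
  have h1 := X_pow_dvd_iff.mp (key (q + 1) le_rfl s₀) i₀ (by have := i₀.isLt; omega)
  simp only [Ψ, w, coeff_mk, i₀.isLt, dite_true, div_eq_zero_iff] at h1
  rcases h1 with h1 | h1
  · exact hg0 h1
  · exact absurd h1 (by exact_mod_cast (i₀ : ℕ).factorial_ne_zero)

end Curves

/-! ### Jets of horizontal curves in terms of controls -/

section Jets

open PowerSeries Filter Topology

/-- The control series with constant terms `v` and coefficients `w` in orders `1, …, α`. -/
noncomputable def ctrl {n : ℕ} {R : Type*} [CommRing R] [Algebra ℝ R] (α : ℕ) (v : Fin n → ℝ)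
    (w : Fin α × Fin n → R) (k : Fin n) : R⟦X⟧ :=
  PowerSeries.mk fun m => match m with
    | 0 => algebraMap ℝ R (v k)
    | m + 1 => if h : m < α then w (⟨m, h⟩, k) else 0

section Ctrl

variable {n α : ℕ} {R : Type*} [CommRing R] [Algebra ℝ R] (v : Fin n → ℝ)
  (w : Fin α × Fin n → R) (k : Fin n)

theorem coeff_zero_ctrl : coeff 0 (ctrl α v w k) = algebraMap ℝ R (v k) := by simp [ctrl]

theorem coeff_succ_ctrl {m : ℕ} (h : m < α) : coeff (m + 1) (ctrl α v w k) = w (⟨m, h⟩, k) := by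
  simp [ctrl, h]

theorem coeff_succ_ctrl_of_le {m : ℕ} (h : α ≤ m) : coeff (m + 1) (ctrl α v w k) = 0 := by
  simp [ctrl, not_lt.mpr h]

theorem map_ctrl {R' : Type*} [CommRing R'] [Algebra ℝ R'] (φ : R →ₐ[ℝ] R') :
    PowerSeries.map (φ : R →+* R') (ctrl α v w k) = ctrl α v (fun i => φ (w i)) k := by
  ext m
  rw [coeff_map]
  cases m with
  | zero => rw [coeff_zero_ctrl, coeff_zero_ctrl]; exact φ.commutes _
  | succ m =>
    by_cases h : m < α
    · rw [coeff_succ_ctrl v w k h, coeff_succ_ctrl _ _ _ h]; rfl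
    · rw [coeff_succ_ctrl_of_le v w k (not_lt.mp h), coeff_succ_ctrl_of_le _ _ _ (not_lt.mp h),
        map_zero]

end Ctrl

variable {n p N α : ℕ}

/-- The coordinates of the jet of a curve starting at `y` whose controls along the frame `X'` have
coefficients `v` (order `0`) and `w` (orders `1, …, α`), in any real algebra. -/
noncomputable def jetOf {R : Type*} [CommRing R] [Algebra ℝ R]
    (X' : Fin n → (Fin N → ℝ) → (Fin N → ℝ)) (y : Fin N → ℝ) (v : Fin n → ℝ)
    (w : Fin α × Fin n → R) (b : Fin (α + 1 + 1) × Fin N) : R :=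
  ((b.1 : ℕ).factorial : ℝ) • coeff (b.1 : ℕ) (flow (ctrl α v w)
    (fun J => algebraMap ℝ R (wordDeriv X' (fun z => z b.2) J y)) [])

theorem map_jetOf {R R' : Type*} [CommRing R] [Algebra ℝ R] [CommRing R'] [Algebra ℝ R']
    (φ : R →ₐ[ℝ] R') (X' : Fin n → (Fin N → ℝ) → (Fin N → ℝ)) (y : Fin N → ℝ) (v : Fin n → ℝ)
    (w : Fin α × Fin n → R) (b : Fin (α + 1 + 1) × Fin N) :
    φ (jetOf X' y v w b) = jetOf X' y v (fun i => φ (w i)) b := by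
  have h := congrArg (coeff (b.1 : ℕ)) (map_flow φ (ctrl α v w)
    (fun J => algebraMap ℝ R (wordDeriv X' (fun z => z b.2) J y)) [])
  rw [coeff_map] at h
  simp only [map_ctrl, AlgHom.commutes] at h
  rw [jetOf, map_smul, jetOf, ← h]
  rfl

/-- The initial values of the formal flow pairing the covector `∑ₛ ψₛ λˢ` at `y` with the iterated
brackets of the frame. -/
noncomputable def pairInit {R : Type*} [CommRing R] [Algebra ℝ R]
    (lam : Fin p → (Fin N → ℝ) → ((Fin N → ℝ) →L[ℝ] ℝ))
    (X' : Fin n → (Fin N → ℝ) → (Fin N → ℝ)) (y : Fin N → ℝ) (ψ : Fin p → R)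
    (J : List (Fin n)) : R :=
  ∑ s, lam s y (wordField X' J y) • ψ s

theorem map_pairInit {R R' : Type*} [CommRing R] [Algebra ℝ R] [CommRing R'] [Algebra ℝ R']
    (φ : R →ₐ[ℝ] R') (lam : Fin p → (Fin N → ℝ) → ((Fin N → ℝ) →L[ℝ] ℝ))
    (X' : Fin n → (Fin N → ℝ) → (Fin N → ℝ)) (y : Fin N → ℝ) (ψ : Fin p → R)
    (J : List (Fin n)) :
    φ (pairInit lam X' y ψ J) = pairInit lam X' y (fun s => φ (ψ s)) J := by
  simp [pairInit, map_sum]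

variable {lam : Fin p → (Fin N → ℝ) → ((Fin N → ℝ) →L[ℝ] ℝ)}
  {V : Set (Fin N → ℝ)} {ξ : Fin n → (Fin N → ℝ) →L[ℝ] ℝ}
  {X' : Fin n → (Fin N → ℝ) → (Fin N → ℝ)} {u : ℝ → Fin N → ℝ} {x : ℝ}

/-- The coefficients, in orders `1, …, α`, of the controls of a curve. -/
noncomputable def controlCoeff (ξ : Fin n → (Fin N → ℝ) →L[ℝ] ℝ) (u : ℝ → Fin N → ℝ) (x : ℝ)
    (α : ℕ) (b : Fin α × Fin n) : ℝ :=
  coeff ((b.1 : ℕ) + 1) (taylorAt x fun t => ξ b.2 (deriv u t))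

theorem X_pow_dvd_taylorAt_sub_ctrl (ξ : Fin n → (Fin N → ℝ) →L[ℝ] ℝ) (u : ℝ → Fin N → ℝ) (x : ℝ)
    (α : ℕ) (k : Fin n) :
    (X : ℝ⟦X⟧) ^ (α + 1) ∣ taylorAt x (fun t => ξ k (deriv u t)) -
      ctrl α (fun k => ξ k (deriv u x)) (controlCoeff ξ u x α) k := by
  rw [X_pow_dvd_iff]
  intro m hm
  rw [map_sub, sub_eq_zero]
  cases m with
  | zero => rw [coeff_zero_ctrl, coeff_zero_taylorAt]; rfl
  | succ m => rw [coeff_succ_ctrl _ _ _ (by omega : m < α)]; rfl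

theorem X_pow_dvd_velocity_sub_ctrl (hF : IsAdaptedFrame lam V ξ X')
    (hsm : ∀ s, ContDiff ℝ ∞ (lam s)) (hu : ContDiff ℝ ∞ u) (hx : u x ∈ V)
    (hh : ∀ i ≤ α, iteratedDeriv i (horizOp lam u) x = 0) (μ : Fin N) :
    (X : ℝ⟦X⟧) ^ (α + 1) ∣ taylorAt x (fun t => deriv u t μ) -
      ∑ k, ctrl α (fun k => ξ k (deriv u x)) (controlCoeff ξ u x α) k *
        taylorAt x (fun t => X' k (u t) μ) := by
  have h1 := X_pow_dvd_velocity_sub hF hsm hu hx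
    (fun i (hi : i < α + 1) => hh i (Nat.lt_succ_iff.mp hi)) μ
  have h2 : (X : ℝ⟦X⟧) ^ (α + 1) ∣ ∑ k, (taylorAt x (fun t => ξ k (deriv u t)) -
      ctrl α (fun k => ξ k (deriv u x)) (controlCoeff ξ u x α) k) *
        taylorAt x (fun t => X' k (u t) μ) :=
    Finset.dvd_sum fun k _ => Dvd.dvd.mul_right (X_pow_dvd_taylorAt_sub_ctrl ξ u x α k) _
  simp only [sub_mul, Finset.sum_sub_distrib] at h2
  convert dvd_add h1 h2 using 1
  ring

/-- The jet of a curve, horizontal to order `α`, is determined by its controls. -/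
theorem jet_eq_jetOf (hF : IsAdaptedFrame lam V ξ X')
    (hsm : ∀ s, ContDiff ℝ ∞ (lam s)) (hu : ContDiff ℝ ∞ u) (hx : u x ∈ V)
    (hh : ∀ i ≤ α, iteratedDeriv i (horizOp lam u) x = 0) (b : Fin (α + 1 + 1) × Fin N) :
    jet (α + 1) u x b =
      jetOf X' (u x) (fun k => ξ k (deriv u x)) (controlCoeff ξ u x α) b := by
  have h := X_pow_dvd_taylorAt_sub_flow hF.isOpen hF.contDiffOn hu hx
    (X_pow_dvd_velocity_sub_ctrl hF hsm hu hx hh) (G := fun z => z b.2)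
    (contDiff_apply ℝ ℝ b.2).contDiffOn []
  have h1 := X_pow_dvd_iff.mp h (b.1 : ℕ) b.1.isLt
  rw [map_sub, sub_eq_zero] at h1
  rw [jet, iteratedDeriv_apply_of_contDiffAt hu.contDiffAt, iteratedDeriv_eq_coeff_taylorAt, jetOf]
  exact congrArg _ h1

theorem wordDeriv_singleton_coord (k : Fin n) (μ : Fin N) (z : Fin N → ℝ) :
    wordDeriv X' (fun z => z μ) [k] z = X' k z μ := by
  have : fderiv ℝ (fun z : Fin N → ℝ => z μ) z
      = ContinuousLinearMap.proj (R := ℝ) (φ := fun _ : Fin N => ℝ) μ :=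
    (ContinuousLinearMap.proj (R := ℝ) (φ := fun _ : Fin N => ℝ) μ).hasFDerivAt.fderiv
  simp [wordDeriv, this]

/-- Every choice of controls is realised by a curve which is horizontal to order `α`: a Taylor
polynomial of the formal flow on coordinate functions. -/
theorem exists_curve_of_controls (hF : IsAdaptedFrame lam V ξ X')
    (hsm : ∀ s, ContDiff ℝ ∞ (lam s)) {y : Fin N → ℝ} (hy : y ∈ V) (v : Fin n → ℝ)
    (w : Fin α × Fin n → ℝ) (x : ℝ) :
    ∃ u : ℝ → Fin N → ℝ, ContDiff ℝ ∞ u ∧ jet (α + 1) u x = jetOf X' y v w ∧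
      ∀ i ≤ α, iteratedDeriv i (horizOp lam u) x = 0 := by
  let f : Fin N → List (Fin n) → ℝ⟦X⟧ := fun μ =>
    flow (ctrl α v w) (fun J => wordDeriv X' (fun z => z μ) J y)
  let u : ℝ → Fin N → ℝ := fun t μ => (trunc (α + 2) (f μ [])).eval (t - x)
  have hu : ContDiff ℝ ∞ u := by
    refine contDiff_pi.mpr fun μ => ?_
    exact ((trunc (α + 2) (f μ [])).contDiff_aeval (𝕜 := ℝ) ∞).comp
      (contDiff_id.sub (contDiff_const (c := x)))
  have hT : ∀ μ, taylorAt x (fun t => u t μ) = (trunc (α + 2) (f μ []) : ℝ⟦X⟧) := fun μ =>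
    taylorAt_polynomial x _
  have hTf : ∀ μ, (X : ℝ⟦X⟧) ^ (α + 2) ∣ taylorAt x (fun t => u t μ) - f μ [] := by
    intro μ
    rw [hT, X_pow_dvd_iff]
    intro m hm
    rw [map_sub, Polynomial.coeff_coe, coeff_trunc, if_pos hm, sub_self]
  have hux : u x = y := by
    ext μ
    have h1 := X_pow_dvd_iff.mp (hTf μ) 0 (by omega)
    rw [map_sub, sub_eq_zero, coeff_zero_taylorAt, coeff_zero_flow] at h1
    exact h1
  have hdu : ∀ μ, (X : ℝ⟦X⟧) ^ (α + 1) ∣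
      taylorAt x (fun t => deriv u t μ) - ∑ k, ctrl α v w k * f μ [k] := by
    intro μ
    have h1 : taylorAt x (fun t => deriv u t μ) = d⁄dX ℝ (taylorAt x (fun t => u t μ)) := by
      rw [derivative_taylorAt]
      congr 1
      ext t
      rw [deriv_pi fun i => ((contDiff_pi.mp hu i).differentiable (by simp)).differentiableAt]
    rw [h1, ← derivative_flow, ← map_sub, X_pow_dvd_iff]
    intro m hm
    rw [coeff_derivative, X_pow_dvd_iff.mp (hTf μ) (m + 1) (by omega), zero_mul]
  have key : ∀ e ≤ α + 1, ∀ μ, (X : ℝ⟦X⟧) ^ e ∣ taylorAt x (fun t => deriv u t μ) -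
      ∑ k, ctrl α v w k * taylorAt x (fun t => X' k (u t) μ) := by
    intro e
    induction e with
    | zero => intro _ μ; simp
    | succ e ih =>
      intro he μ
      have h1 : ∀ k, (X : ℝ⟦X⟧) ^ (e + 1) ∣ taylorAt x (fun t => X' k (u t) μ) - f μ [k] := by
        intro k
        have := X_pow_dvd_taylorAt_sub_flow hF.isOpen hF.contDiffOn hu (hux ▸ hy)
          (ih (by omega)) (G := fun z => z μ) (contDiff_apply ℝ ℝ μ).contDiffOn [k]
        simp only [wordDeriv_singleton_coord, hux] at this
        exact this
      have h2 : (X : ℝ⟦X⟧) ^ (e + 1) ∣ ∑ k, ctrl α v w k *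
          (taylorAt x (fun t => X' k (u t) μ) - f μ [k]) :=
        Finset.dvd_sum fun k _ => Dvd.dvd.mul_left (h1 k) _
      simp only [mul_sub, Finset.sum_sub_distrib] at h2
      convert dvd_sub ((pow_dvd_pow _ he).trans (hdu μ)) h2 using 1
      ring
  refine ⟨u, hu, ?_, fun i hi => iteratedDeriv_horizOp_eq_zero hF hsm hu (hux ▸ hy)
    (key (α + 1) le_rfl) (Nat.lt_succ_of_le hi)⟩
  ext b
  have h1 := X_pow_dvd_iff.mp (hTf b.2) (b.1 : ℕ) b.1.isLt
  rw [map_sub, sub_eq_zero] at h1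
  rw [jet, iteratedDeriv_apply_of_contDiffAt hu.contDiffAt, iteratedDeriv_eq_coeff_taylorAt, jetOf]
  exact congrArg _ h1

end Jets

/-! ### The polynomial parametrization of horizontal jets -/

section Parametrization

open PowerSeries

variable {n p N α : ℕ}

theorem coeff_flow_mem_of_le {R : Type*} [CommRing R] [Algebra ℝ R] (A : Subalgebra ℝ R)
    {a : Fin n → R⟦X⟧} {c : List (Fin n) → R} (hc : ∀ J, c J ∈ A) {e : ℕ}
    (ha : ∀ k, ∀ i < e, coeff i (a k) ∈ A) (j : ℕ) (hj : j ≤ e) (J : List (Fin n)) :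
    coeff j (flow a c J) ∈ A := by
  have key : ∀ j ≤ e, ∀ J, flowCoeff a c j J ∈ A := by
    intro j
    induction j using Nat.strong_induction_on with
    | _ j ih =>
    intro hj J
    cases j with
    | zero => rw [flowCoeff]; exact hc J
    | succ j =>
      rw [flowCoeff]
      refine A.smul_mem (Subalgebra.sum_mem _ fun k _ => Subalgebra.sum_mem _ fun i _ => ?_) _
      exact A.mul_mem (ha k _ (by omega)) (ih i (by omega) (by omega) _)
  rw [flow, coeff_mk]
  exact key j hj J

/-- The coefficients of the controls are polynomials in the coordinates of the jet: the control of
order `m + 1` is recovered, by the dual covectors `ξ k`, from the coordinates of order `m + 2` and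
the controls of lower order. -/
theorem X_mem_adjoin_jetOf {lam : Fin p → (Fin N → ℝ) → ((Fin N → ℝ) →L[ℝ] ℝ)}
    {V : Set (Fin N → ℝ)} {ξ : Fin n → (Fin N → ℝ) →L[ℝ] ℝ}
    {X' : Fin n → (Fin N → ℝ) → (Fin N → ℝ)} (hF : IsAdaptedFrame lam V ξ X')
    {y : Fin N → ℝ} (hy : y ∈ V) (v : Fin n → ℝ) (i : Fin α × Fin n) :
    (MvPolynomial.X i : MvPolynomial (Fin α × Fin n) ℝ) ∈
      Algebra.adjoin ℝ (Set.range (jetOf X' y v MvPolynomial.X)) := by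
  set A := Algebra.adjoin ℝ (Set.range (jetOf (α := α) X' y v
    (MvPolynomial.X : Fin α × Fin n → MvPolynomial (Fin α × Fin n) ℝ))) with hA
  let a := ctrl α v (MvPolynomial.X : Fin α × Fin n → MvPolynomial (Fin α × Fin n) ℝ)
  let c : Fin N → List (Fin n) → MvPolynomial (Fin α × Fin n) ℝ := fun μ J =>
    algebraMap ℝ _ (wordDeriv X' (fun z => z μ) J y)
  have hc : ∀ μ J, c μ J ∈ A := fun μ J => A.algebraMap_mem _
  have hjet : ∀ m < α + 2, ∀ μ, coeff m (flow a (c μ) []) ∈ A := by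
    intro m hm μ
    have h1 : jetOf X' y v MvPolynomial.X ((⟨m, hm⟩ : Fin (α + 1 + 1)), μ) ∈ A :=
      Algebra.subset_adjoin ⟨_, rfl⟩
    have h2 := A.smul_mem h1 ((m.factorial : ℝ)⁻¹)
    rwa [jetOf, inv_smul_smul₀ (by exact_mod_cast m.factorial_ne_zero)] at h2
  have key : ∀ m ≤ α, ∀ k, coeff m (a k) ∈ A := by
    intro m
    induction m using Nat.strong_induction_on with
    | _ m ih =>
    intro hm k
    cases m with
    | zero => rw [coeff_zero_ctrl]; exact A.algebraMap_mem _
    | succ m =>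
      have hlow : ∀ k, ∀ i < m + 1, coeff i (a k) ∈ A := fun k i hi => ih i hi (by omega) k
      have hsum : ∀ μ, ∑ k, coeff (m + 1) (a k) * c μ [k] ∈ A := by
        intro μ
        have h1 := congrArg (coeff (m + 1)) (derivative_flow a (c μ) [])
        rw [coeff_derivative, map_sum] at h1
        have h2 : ∀ k, coeff (m + 1) (a k * flow a (c μ) [k]) =
            ∑ i ∈ Finset.range (m + 1), coeff i (a k) * coeff (m + 1 - i) (flow a (c μ) [k])
              + coeff (m + 1) (a k) * c μ [k] := by
          intro k
          rw [coeff_mul, Finset.Nat.sum_antidiagonal_eq_sum_range_succ_mk, Finset.sum_range_succ,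
            Nat.sub_self, coeff_zero_flow]
        simp only [h2, Finset.sum_add_distrib] at h1
        rw [← sub_eq_iff_eq_add'] at h1
        rw [← h1]
        refine A.sub_mem (A.mul_mem (hjet _ (by omega) μ) ?_) (Subalgebra.sum_mem _ fun k _ =>
          Subalgebra.sum_mem _ fun i hi => ?_)
        · exact A.add_mem (natCast_mem A _) A.one_mem
        · have hi := Finset.mem_range.mp hi
          exact A.mul_mem (hlow k i hi) (coeff_flow_mem_of_le A (hc μ) hlow _ (by omega) _)
      have h3 : coeff (m + 1) (a k)
          = ∑ μ, ξ k (Pi.single μ 1) • ∑ k', coeff (m + 1) (a k') * c μ [k'] := by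
        simp only [Finset.smul_sum]
        rw [Finset.sum_comm]
        have h4 : ∀ k', ∑ μ, ξ k (Pi.single μ 1) • (coeff (m + 1) (a k') * c μ [k'])
            = coeff (m + 1) (a k') * algebraMap ℝ _ (ξ k (X' k' y)) := by
          intro k'
          rw [ContinuousLinearMap.apply_eq_sum_single, map_sum, Finset.mul_sum]
          refine Finset.sum_congr rfl fun μ _ => ?_
          rw [map_mul, Algebra.smul_def]
          simp only [c, wordDeriv_singleton_coord]
          ring
        simp only [h4, hF.dual y hy]
        simp
      rw [h3]
      exact Subalgebra.sum_mem _ fun μ _ => A.smul_mem (hsum μ) _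
  have := key (i.1 + 1) i.1.isLt i.2
  rwa [coeff_succ_ctrl _ _ _ i.1.isLt] at this

/-- If the entries of `ψ` are not all zero, a flow whose initial values are the pairings of
`∑ₛ ψₛ λˢ` with iterated brackets which span does not start at zero. -/
theorem exists_pairInit_ne_zero {F : Type*} [Field F] [Algebra ℝ F]
    {lam : Fin p → (Fin N → ℝ) → ((Fin N → ℝ) →L[ℝ] ℝ)}
    {X' : Fin n → (Fin N → ℝ) → (Fin N → ℝ)} {y : Fin N → ℝ}
    (hli : LinearIndependent ℝ fun s => lam s y) {i : ℕ}
    (hspan : Submodule.span ℝ {v | ∃ J : List (Fin n), J ≠ [] ∧ J.length ≤ i ∧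
      wordField X' J y = v} = ⊤) {ψ : Fin p → F} (hψ : ∃ s, ψ s ≠ 0) :
    ∃ J : List (Fin n), 1 ≤ J.length ∧ J.length ≤ i ∧ pairInit lam X' y ψ J ≠ 0 := by
  by_contra hcon
  push Not at hcon
  obtain ⟨s₀, hs₀⟩ := hψ
  refine hs₀ ((Module.forall_dual_apply_eq_zero_iff ℝ (ψ s₀)).mp fun τ => ?_)
  refine Fintype.linearIndependent_iff.mp hli (fun s => τ (ψ s)) ?_ s₀
  apply ContinuousLinearMap.coe_injective
  refine LinearMap.ext_on hspan ?_
  rintro _ ⟨J, hJ1, hJ2, rfl⟩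
  have h1 := hcon J (List.length_pos_iff.mpr hJ1) hJ2
  have h2 := congrArg τ h1
  rw [pairInit, map_sum, map_zero] at h2
  simp only [map_smul, smul_eq_mul] at h2
  simpa [mul_comm] using h2

end Parametrization

/-! ### Jets with a singular regularity matrix -/

section Singular

open PowerSeries

variable {n p N α : ℕ}

/-- The ideal of the pairs of a covector `ψ` at the base point, normalised by `ψ s₀ = 1`, and of
coefficients of controls, for which the pairing of the transported covector with the frame vanishes
to order `q + 2`. -/
noncomputable def singularIdeal (lam : Fin p → (Fin N → ℝ) → ((Fin N → ℝ) →L[ℝ] ℝ))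
    (X' : Fin n → (Fin N → ℝ) → (Fin N → ℝ)) (y : Fin N → ℝ) (v : Fin n → ℝ) (α q : ℕ)
    (s₀ : Fin p) : Ideal (MvPolynomial (Fin p ⊕ Fin α × Fin n) ℝ) :=
  Ideal.span ({g | ∃ m k, m < q + 2 ∧
    g = coeff m (flow (ctrl α v fun i => MvPolynomial.X (Sum.inr i))
      (pairInit lam X' y fun s => MvPolynomial.X (Sum.inl s)) [k])} ∪
    {MvPolynomial.X (Sum.inl s₀) - 1})

theorem map_coeff_flow_pairInit {R R' : Type*} [CommRing R] [Algebra ℝ R] [CommRing R']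
    [Algebra ℝ R'] (φ : R →ₐ[ℝ] R') (lam : Fin p → (Fin N → ℝ) → ((Fin N → ℝ) →L[ℝ] ℝ))
    (X' : Fin n → (Fin N → ℝ) → (Fin N → ℝ)) (y : Fin N → ℝ) (v : Fin n → ℝ)
    (w : Fin α × Fin n → R) (ψ : Fin p → R) (m : ℕ) (J : List (Fin n)) :
    φ (coeff m (flow (ctrl α v w) (pairInit lam X' y ψ) J))
      = coeff m (flow (ctrl α v fun i => φ (w i)) (pairInit lam X' y fun s => φ (ψ s)) J) := by
  have h := congrArg (coeff m) (map_flow φ (ctrl α v w) (pairInit lam X' y ψ) J)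
  rw [coeff_map] at h
  simp only [map_ctrl, map_pairInit] at h
  exact h

/-- A curve, horizontal to order `α`, whose regularity matrix is singular gives a real point of one
of the singular ideals. -/
theorem exists_singular_point {lam : Fin p → (Fin N → ℝ) → ((Fin N → ℝ) →L[ℝ] ℝ)}
    {V : Set (Fin N → ℝ)} {ξ : Fin n → (Fin N → ℝ) →L[ℝ] ℝ}
    {X' : Fin n → (Fin N → ℝ) → (Fin N → ℝ)} (hF : IsAdaptedFrame lam V ξ X')
    (hsm : ∀ s, ContDiff ℝ ∞ (lam s)) {u : ℝ → Fin N → ℝ} {x : ℝ} (hu : ContDiff ℝ ∞ u)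
    (hx : u x ∈ V) (hh : ∀ i ≤ α, iteratedDeriv i (horizOp lam u) x = 0) {q : ℕ} (hq : q ≤ α)
    (hli : LinearIndependent ℝ (fun s => lam s (u x)))
    (hdep : ¬ LinearIndependent ℝ (fun a => regMatrix lam q u x a)) :
    ∃ (s₀ : Fin p) (ψ : Fin p → ℝ), ∀ g ∈ singularIdeal lam X' (u x)
      (fun k => ξ k (deriv u x)) α q s₀,
      MvPolynomial.aeval (Sum.elim ψ (controlCoeff ξ u x α)) g = 0 := by
  obtain ⟨Ψ, ⟨s₀, hs₀⟩, hΨ⟩ := exists_adjoint_solution hli hdep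
  -- rescale so that the coordinate `s₀` of the covector is `1`
  let Ψ' : Fin p → ℝ⟦X⟧ := fun s => (coeff 0 (Ψ s₀))⁻¹ • Ψ s
  have hΨ' : ∀ μ, (X : ℝ⟦X⟧) ^ (q + 1) ∣ ∑ s, (Ψ' s * taylorAt x (entryR lam u s μ)
      + d⁄dX ℝ (Ψ' s) * taylorAt x (entryLambda lam u s μ)) := by
    intro μ
    have h1 := Dvd.dvd.mul_left (hΨ μ) (C (coeff 0 (Ψ s₀))⁻¹)
    rw [← smul_eq_C_mul, Finset.smul_sum] at h1
    convert h1 using 3 with s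
    simp only [Ψ', Derivation.map_smul, smul_add, smul_mul_assoc]
  have ha : ∀ μ, (X : ℝ⟦X⟧) ^ (q + 1) ∣ taylorAt x (fun t => deriv u t μ) -
      ∑ k, ctrl α (fun k => ξ k (deriv u x)) (controlCoeff ξ u x α) k *
        taylorAt x (fun t => X' k (u t) μ) := fun μ =>
    (pow_dvd_pow _ (by omega)).trans (X_pow_dvd_velocity_sub_ctrl hF hsm hu hx hh μ)
  have hflow := X_pow_dvd_flow_singleton hF hsm hu hx ha hΨ'
  refine ⟨s₀, fun s => coeff 0 (Ψ' s), fun g hg => ?_⟩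
  have hle : singularIdeal lam X' (u x) (fun k => ξ k (deriv u x)) α q s₀ ≤
      RingHom.ker (MvPolynomial.aeval (Sum.elim (fun s => coeff 0 (Ψ' s))
        (controlCoeff ξ u x α)) : MvPolynomial (Fin p ⊕ Fin α × Fin n) ℝ →ₐ[ℝ] ℝ) := by
    refine Ideal.span_le.mpr ?_
    rintro g (⟨m, k, hm, rfl⟩ | hg)
    · change MvPolynomial.aeval _ _ = 0
      rw [map_coeff_flow_pairInit]
      simp only [MvPolynomial.aeval_X, Sum.elim_inl, Sum.elim_inr]
      have h2 := X_pow_dvd_iff.mp (hflow k) m hm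
      have h3 : (pairInit lam X' (u x) fun s => coeff 0 (Ψ' s))
          = fun J => ∑ s, coeff 0 (Ψ' s) * lam s (u x) (wordField X' J (u x)) := by
        funext J
        simp [pairInit, mul_comm]
      rw [h3]
      exact h2
    · rw [Set.mem_singleton_iff.mp hg]
      change MvPolynomial.aeval _ _ = 0
      rw [map_sub, MvPolynomial.aeval_X, Sum.elim_inl, map_one, sub_eq_zero]
      simp only [Ψ', map_smul, smul_eq_mul]
      exact inv_mul_cancel₀ hs₀
  exact hle hg

/-- The components of the singular ideals have dimension at most `α n - K`: of the `p + α n`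
coordinates, `K + p` controls are determined, and `p` of these make up for the covector. -/
theorem card_le_of_singularIdeal_le {lam : Fin p → (Fin N → ℝ) → ((Fin N → ℝ) →L[ℝ] ℝ)}
    {X' : Fin n → (Fin N → ℝ) → (Fin N → ℝ)} {y : Fin N → ℝ}
    (hli : LinearIndependent ℝ fun s => lam s y) {r : ℕ}
    (hspan : Submodule.span ℝ {v | ∃ J : List (Fin n), J ≠ [] ∧ J.length ≤ r + 1 ∧
      wordField X' J y = v} = ⊤) (v : Fin n → ℝ) {K q : ℕ} (hq : q ≤ α)
    (hK : depthBound (K + p) r ≤ q + 2) (s₀ : Fin p)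
    (P : Ideal (MvPolynomial (Fin p ⊕ Fin α × Fin n) ℝ)) (hP : P.IsPrime)
    (hIP : singularIdeal lam X' y v α q s₀ ≤ P) (d : ℕ)
    (z : Fin d → MvPolynomial (Fin p ⊕ Fin α × Fin n) ℝ ⧸ P) (hz : AlgebraicIndependent ℝ z) :
    d ≤ α * n - K := by
  classical
  let B := MvPolynomial (Fin p ⊕ Fin α × Fin n) ℝ ⧸ P
  let F := FractionRing B
  let φ : MvPolynomial (Fin p ⊕ Fin α × Fin n) ℝ →ₐ[ℝ] F :=
    (IsScalarTower.toAlgHom ℝ B F).comp (Ideal.Quotient.mkₐ ℝ P)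
  have hφP : ∀ g ∈ P, φ g = 0 := by
    intro g hg
    change algebraMap B F (Ideal.Quotient.mk P g) = 0
    rw [Ideal.Quotient.eq_zero_iff_mem.mpr hg, map_zero]
  let ψ : Fin p → F := fun s => φ (MvPolynomial.X (Sum.inl s))
  let w : Fin α × Fin n → F := fun i => φ (MvPolynomial.X (Sum.inr i))
  let f := flow (ctrl α v w) (pairInit lam X' y ψ)
  have hψ : ψ s₀ ≠ 0 := by
    have h1 := hφP _ (hIP (Ideal.subset_span (Or.inr rfl)))
    rw [map_sub, map_one, sub_eq_zero] at h1
    change φ _ ≠ 0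
    rw [h1]
    exact one_ne_zero
  have hf1 : ∀ J : List (Fin n), J.length = 1 → (X : F⟦X⟧) ^ depthBound (K + p) r ∣ f J := by
    intro J hJ
    obtain ⟨k, rfl⟩ := List.length_eq_one_iff.mp hJ
    rw [X_pow_dvd_iff]
    intro m hm
    have h1 := hφP _ (hIP (Ideal.subset_span (Or.inl ⟨m, k, by omega, rfl⟩)))
    rwa [map_coeff_flow_pairInit] at h1
  have hf0 : ∃ J : List (Fin n), 1 ≤ J.length ∧ J.length ≤ 1 + r ∧ coeff 0 (f J) ≠ 0 := by
    obtain ⟨J, h1, h2, h3⟩ := exists_pairInit_ne_zero (F := F) hli hspan ⟨s₀, hψ⟩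
    exact ⟨J, h1, by omega, by rwa [coeff_zero_flow]⟩
  obtain ⟨k, S, hS, hSm, hδ⟩ := exists_determined_controls (F := F) (a := ctrl α v w) (f := f)
    (fun J => derivative_flow _ _ J) (K + p) r 1 hf1 hf0
  have hSα : ∀ m ∈ S, 1 ≤ m ∧ m - 1 < α := fun m hm => by
    have := hSm m hm
    omega
  -- the coefficients of orders in `S` of the `k`-th control are determined by the others
  let T : Finset (Fin p ⊕ Fin α × Fin n) :=
    S.attach.image fun m => Sum.inr (⟨m.1 - 1, (hSα m.1 m.2).2⟩, k)
  have hTc : T.card = S.card := by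
    rw [Finset.card_image_of_injective, Finset.card_attach]
    intro m m' h
    have h1 : m.1 - 1 = m'.1 - 1 := by simpa using h
    have h2 := (hSα m.1 m.2).1
    have h3 := (hSα m'.1 m'.2).1
    exact Subtype.ext (by omega)
  have hcard := card_le_of_derivation_eq_zero P Tᶜ (fun δ hδT => ?_) z hz
  · have h1 := Finset.card_compl_add_card T
    have h2 : Fintype.card (Fin p ⊕ Fin α × Fin n) = p + α * n := by simp
    omega
  · have hgen : ∀ g, g ∉ T → δ (φ (MvPolynomial.X g)) = 0 := fun g hg =>
      hδT g (Finset.mem_compl.mpr hg)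
    have hψ0 : ∀ s, δ (ψ s) = 0 := fun s => hgen _ (by simp [T])
    have hdet := hδ δ (fun J => ?_) (fun k' m hkm => ?_)
    · intro g
      by_cases hg : g ∈ T
      · obtain ⟨⟨m, hm⟩, -, rfl⟩ := Finset.mem_image.mp hg
        have h1 := hdet m hm
        obtain ⟨m, rfl⟩ := Nat.exists_eq_add_of_le' (hSα m hm).1
        have hlt : m < α := (hSα _ hm).2
        rw [coeff_succ_ctrl _ _ _ hlt] at h1
        exact h1
      · exact hgen g hg
    · change δ (coeff 0 (flow _ _ J)) = 0
      rw [coeff_zero_flow, pairInit, map_sum]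
      refine Finset.sum_eq_zero fun s _ => ?_
      rw [δ.map_smul, hψ0, smul_zero]
    · cases m with
      | zero => rw [coeff_zero_ctrl]; exact δ.map_algebraMap _
      | succ m =>
        by_cases hm : m < α
        · rw [coeff_succ_ctrl _ _ _ hm]
          refine hgen _ fun hmem => ?_
          obtain ⟨⟨m', hm'⟩, -, h1⟩ := Finset.mem_image.mp hmem
          have h2 : m' - 1 = m ∧ k = k' := by simpa using h1
          have h3 := (hSα m' hm').1
          rcases hkm with h | h
          · exact h h2.2.symm
          · have : m' = m + 1 := by omega
            exact h (this ▸ hm')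
        · rw [coeff_succ_ctrl_of_le _ _ _ (not_lt.mp hm), map_zero]

end Singular

theorem theorem3p4 (n p N : ℕ) (hN : N = n + p) (q₀ : ℕ) (hq₀ : (p : ℤ) - n ≤ n * q₀)
    (r : ℕ) (m : Fin (r + 2) → ℕ) (K : ℕ) (hK : 1 ≤ K) :
    ∃ Q : ℕ, q₀ ≤ Q ∧
      ∀ (D : (Fin N → ℝ) → Submodule ℝ (Fin N → ℝ))
        (lam : Fin p → (Fin N → ℝ) → ((Fin N → ℝ) →L[ℝ] ℝ)),
        IsDistribution n D → IsBracketGenerating D → IsDefiningCoframe D lam →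
        ∀ (x : ℝ) (σ : JetAt 1 N), σ ∈ tangJets lam 0 x → jetVelocity σ ≠ 0 →
          HasTypeAt D m (jetValue σ) →
          ∀ (q α : ℕ) (_ : Q ≤ q) (hqα : q ≤ α),
            CodimAtLeast K
              (jetsOver (tangJets lam α x) σ \ jetsOver (regTangJets lam hqα x) σ)
              (jetsOver (tangJets lam α x) σ) := by
  -- `K ≤ q` makes `α n - K` an untruncated difference
  refine ⟨max q₀ (max K (depthBound (K + p) r)), le_max_left _ _, ?_⟩
  intro D lam hD _ hlam x σ hσ hvel htype q α hQ hqα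
  have hsm := hlam.1
  have hli := hlam.2.1
  have hKq : K ≤ q := (le_max_left _ _).trans ((le_max_right _ _).trans hQ)
  have hBq : depthBound (K + p) r ≤ q := (le_max_right _ _).trans ((le_max_right _ _).trans hQ)
  set y := jetValue σ with hy
  obtain ⟨V, ξ, X', hyV, hF⟩ := exists_isAdaptedFrame hN hD hlam y
  let v : Fin n → ℝ := fun k => ξ k (jetVelocity σ)
  -- a curve whose jet projects to `σ` has value `y` and velocity that of `σ`
  have hproj : ∀ (u : ℝ → Fin N → ℝ), ContDiff ℝ ∞ u →
      jetProj (Nat.succ_le_succ (Nat.zero_le α)) (jet (α + 1) u x) = σ →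
      u x = y ∧ deriv u x = jetVelocity σ := by
    intro u _ h
    refine ⟨funext fun μ => ?_, funext fun μ => ?_⟩
    · have h1 : u x μ = σ (0, μ) := by simpa [jetProj, jet] using congrFun h (0, μ)
      exact h1
    · have h1 : deriv u x μ = σ (1, μ) := by simpa [jetProj, jet] using congrFun h (1, μ)
      exact h1
  -- the velocity of `σ` is a combination of the frame
  have hvelsum : ∑ k, v k • X' k y = jetVelocity σ := by
    obtain ⟨u, hu, hj, hh⟩ := hσ
    have hux : u x = y := by
      ext μ
      have h1 : u x μ = σ (0, μ) := by simpa [jet] using congrFun hj (0, μ)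
      exact h1
    have hdu : deriv u x = jetVelocity σ := by
      ext μ
      have h1 : deriv u x μ = σ (1, μ) := by simpa [jet] using congrFun hj (1, μ)
      exact h1
    symm
    rw [← sub_eq_zero]
    refine hF.separating y hyV _ (fun j => ?_) fun s => ?_
    · simp [map_sub, map_sum, hF.dual y hyV, v]
    · have h0 := congrFun (hh 0 le_rfl) s
      simp only [iteratedDeriv_zero, horizOp, hux, hdu] at h0
      rw [map_sub, h0, map_sum]
      simp [hF.lam_eq_zero y hyV]
  have hn : 1 ≤ n := by
    rcases Nat.eq_zero_or_pos n with rfl | h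
    · exact absurd (by rw [← hvelsum]; simp) hvel
    · exact h
  have hspan : Submodule.span ℝ {v | ∃ J : List (Fin n), J ≠ [] ∧ J.length ≤ r + 1 ∧
      wordField X' J y = v} = ⊤ := by
    have htop : flagAt D (r + 1) y = ⊤ := by
      apply Submodule.eq_top_of_finrank_eq
      have h1 := htype.1 (Fin.last (r + 1))
      rw [htype.2] at h1
      simpa using h1
    exact top_le_iff.mp (htop ▸ flagAt_le_span_wordField hlam hF hyV (r + 1))
  have hdimY : ((α * n : ℕ) : WithBot ℕ∞) ≤ algDim (jetsOver (tangJets lam α x) σ) := by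
    have h := le_algDim_of_section (jetsOver (tangJets lam α x) σ)
      (jetOf X' y v (MvPolynomial.X : Fin α × Fin n → MvPolynomial (Fin α × Fin n) ℝ)) ?_
      (X_mem_adjoin_jetOf hF hyV v)
    · simpa using h
    · intro w
      simp only [map_jetOf, MvPolynomial.aeval_X]
      obtain ⟨u, hu, hj, hh⟩ := exists_curve_of_controls hF hsm hyV v w x
      refine ⟨⟨u, hu, hj, hh⟩, ?_⟩
      ext ⟨i, μ⟩
      fin_cases i
      · change ((0 : ℕ).factorial : ℝ) • PowerSeries.coeff 0 (flow _ _ []) = y μ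
        rw [coeff_zero_flow]
        simp [wordDeriv]
      · change ((1 : ℕ).factorial : ℝ) • PowerSeries.coeff 1 (flow _ _ []) = jetVelocity σ μ
        have h1 := congrArg (PowerSeries.coeff 0) (derivative_flow (ctrl α v w)
          (fun J => algebraMap ℝ ℝ (wordDeriv X' (fun z => z μ) J y)) [])
        rw [PowerSeries.coeff_derivative, map_sum] at h1
        simp only [PowerSeries.coeff_mul, Finset.Nat.antidiagonal_zero,
          Finset.sum_singleton, coeff_zero_ctrl, coeff_zero_flow, wordDeriv_singleton_coord,
          Algebra.algebraMap_self, RingHom.id_apply] at h1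
        rw [← hvelsum]
        simpa using h1
  have hdimZ : algDim (jetsOver (tangJets lam α x) σ \ jetsOver (regTangJets lam hqα x) σ)
      ≤ ((α * n - K : ℕ) : WithBot ℕ∞) := by
    refine algDim_le_of_cover _ (α * n - K) (fun s₀ : Fin p => singularIdeal lam X' y v α q s₀)
      (jetOf X' y v fun i => MvPolynomial.X (Sum.inr i)) ?_ ?_
    · rintro j ⟨⟨⟨u, hu, hj, hh⟩, hjσ⟩, hnot⟩
      obtain ⟨hux, hdu⟩ := hproj u hu (hj ▸ hjσ)
      have hdep : ¬ LinearIndependent ℝ (fun a => regMatrix lam q u x a) := by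
        intro hind
        refine hnot ⟨⟨⟨u, hu, ?_, hdu ▸ hvel, hind⟩, ⟨u, hu, hj, hh⟩⟩, hjσ⟩
        rw [← hj]
        rfl
      obtain ⟨s₀, ψ, hψ⟩ := exists_singular_point hF hsm hu (hux ▸ hyV) hh hqα
        (hux ▸ hli y) hdep
      rw [hux, hdu] at hψ
      refine ⟨s₀, Sum.elim ψ (controlCoeff ξ u x α), hψ, fun b => ?_⟩
      rw [map_jetOf]
      simp only [MvPolynomial.aeval_X, Sum.elim_inr]
      have h1 := jet_eq_jetOf hF hsm hu (hux ▸ hyV) hh b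
      rw [hux, hdu, hj] at h1
      exact h1
    · intro s₀ P hP hIP d z hz
      exact card_le_of_singularIdeal_le (hli y) hspan v hqα (by omega) s₀ P hP hIP d z hz
  have hKα : K ≤ α * n := (hKq.trans hqα).trans (Nat.le_mul_of_pos_right α hn)
  calc algDim (jetsOver (tangJets lam α x) σ \ jetsOver (regTangJets lam hqα x) σ)
        + (K : WithBot ℕ∞)
      ≤ ((α * n - K : ℕ) : WithBot ℕ∞) + (K : WithBot ℕ∞) := by gcongr
    _ = ((α * n : ℕ) : WithBot ℕ∞) := by
        rw [← Nat.cast_add, Nat.sub_add_cancel hKα]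
    _ ≤ _ := hdimY
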